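/- Let $\mathbb F$ be an algebraically closed field of characteristic $2$, let $n,l\ge 0$, and let $\mathbf i=(i_1,\dots,i_l)$ with $1\le i_k\le n-1$ be a word for a positive braid $\beta$ on $n$ strands. Let $\Lambda_\beta$ be the Legendrian link given by the rainbow closure of the word, with Lagrangian projection obtained from the front by Ng's resolution, oriented so that the braid runs from left to right, and decorated with one marked point $t_j$ next to the $j$-th right cusp ($1\le j\le n$, from the innermost to the outermost). Let $\mathcal A(\Lambda_\beta)$ be its fully non-commutative Chekanov–Eliashberg dga over $\mathbb Z/2$: it is freely generated by the crossings $b_1,\dots,b_l$ of the braid (degree $0$), the Reeb chords $a_1,\dots,a_n$ of the right cusps (degree $1$) and the invertible variables $t_1^{\pm1},\dots,t_n^{\pm1}$ (degree $0$). The differential of a Reeb chord is the sum of the boundary words of all immersed disks with convex corners whose only positive corner is at that chord; it vanishes on the $t_j^{\pm1}$ and obeys the Leibniz rule. For a commutative $\mathbb F$-algebra $S$, let $\mathrm{Aug}(\Lambda_\beta)(S)$ be the set of unital dga homomorphisms $\mathcal A(\Lambda_\beta)\to(S,0)$ with $S$ in degree $0$; the augmentation variety $\mathrm{Aug}(\Lambda_\beta)$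 is the moduli space of augmentations, that is, the functor $S\mapsto\mathrm{Aug}(\Lambda_\beta)(S)$. Let $Z_i(b)$ be the $n\times n$ matrix that agrees with the identity matrix except for the block $\begin{pmatrix} b&1\\1&0\end{pmatrix}$ in rows and columns $i,i+1$, let $M=Z_{i_1}(b_1)\cdots Z_{i_l}(b_l)$, and let $\Delta_m(M)$ be the determinant of the submatrix formed by the first $m$ rows and columns of $M$. Then: 1. $\mathrm{Aug}(\Lambda_\beta)\cong\mathrm{Spec}\bigl(\mathbb F[b_1,\dots,b_l,t_1^{\pm1},\dots,t_n^{\pm1}]/\mathcal I\bigr)$, where $\mathcal I$ is the ideal generated by the elements $\Delta_m(M)-\prod_{k=1}^m t_k^{-1}$ for $1\le m\le n$. That is, there are bijections, natural in $S$, between $\mathrm{Aug}(\Lambda_\beta)(S)$ and the set of $\mathbb F$-algebra homomorphisms from this ring to $S$, and they match the values of an augmentation at $b_k$ and $t_j$ with the images of the classes of $b_k$ and $t_j$. 2. Through the Reeb coordinates $(b_1,\dots,b_l)$, $\mathrm{Aug}(\Lambda_\beta)$ is the non-vanishing locus of the polynomial $\prod_{m=1}^n\Delta_m(M)$ in $\mathrm{Spec}\,\mathbb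 F[b_1,\dots,b_l]$. That is, for every commutative $\mathbb F$-algebra $S$ the map $\epsilon\mapsto(\epsilon(b_1),\dots,\epsilon(b_l))$ from $\mathrm{Aug}(\Lambda_\beta)(S)$ to $S^l$ is injective, and its image is the set of points at which $\prod_m\Delta_m(M)$ is a unit of $S$ (for $S=\mathbb F$: the points at which it is not zero); and the morphism of schemes $\mathrm{Spec}\bigl(\mathbb F[b_1,\dots,b_l,t_1^{\pm1},\dots,t_n^{\pm1}]/\mathcal I\bigr)\to\mathrm{Spec}\,\mathbb F[b_1,\dots,b_l]$ given by the $b_k$ is an open immersion whose image is the basic open set $\{\prod_m\Delta_m(M)\ne0\}$. -/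

import Mathlib

open AlgebraicGeometry

universe u

/-! ## Lagrangian diagrams

The Lagrangian projection of a Legendrian link is recorded by cutting the plane along vertical lines
into thin vertical strips, each of which contains exactly one elementary piece. In the slab between
two consecutive pieces the strands are numbered `0, 1, 2, …` from top to bottom. The diagrams are
those which Ng's resolution makes out of front diagrams: at every crossing the strand that descends
from left to right is the overstrand, so that the left and the right quadrants have Reeb sign `+`
and the top and the bottom quadrants have Reeb sign `-`. -/

/-- An elementary piece of a Lagrangian diagram; `R` is the set of labels of the Reeb chords
(crossings) and `T` is the set of marked points.
* `left p`: a left extremum, which creates the strands `p` and `p + 1`;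
* `cross p c`: the strands `p` and `p + 1` cross, and the crossing is the Reeb chord `c`;
* `right p t`: a right extremum, at which the strands `p` and `p + 1` end. It carries the marked
  point `t`, and the link is oriented downwards there (it arrives along the strand `p` and leaves
  along the strand `p + 1`). -/
inductive DiagramPiece (R T : Type) : Type
  | left (p : ℕ)
  | cross (p : ℕ) (c : R)
  | right (p : ℕ) (t : T)

/-- A Lagrangian diagram, read from left to right. Slab `s` lies just before piece number `s`
(pieces are numbered from `0`), and slab `s + 1` lies just after it. -/
abbrev LagrangianDiagram (R T : Type) : Type := List (DiagramPiece R T)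

/-- The reduced words in Reeb chords and invertible formal variables: the free product of the free
monoid on the chords and the free group on the marked points. -/
abbrev CEWord (R T : Type) : Type := Monoid.Coprod (FreeMonoid R) (FreeGroup T)

/-- The one-letter word `c`, for a Reeb chord `c`. -/
def chordWord {R : Type} (T : Type) (c : R) : CEWord R T := Monoid.Coprod.inl (FreeMonoid.of c)

/-- The one-letter word `t`, for a marked point `t`; the word `t⁻¹` is `markWord R t⁻¹`. -/
def markWord (R : Type) {T : Type} (t : FreeGroup T) : CEWord R T := Monoid.Coprod.inr t

/-! ## Immersed disks

Let `u` be an orientation-preserving immersion of a disk whose boundary lies on the diagram and whose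
corners are convex. The preimage under `u` of a vertical line in a slab is a disjoint union of
intervals; each of them is mapped onto the segment from a strand `a` (its upper end) down to a strand
`b` (its lower end), `a < b`. Following these intervals from slab to slab one gets a graph, which is a
tree because the domain is a disk. Up to reparametrization `u` is determined by this tree with its
labels, and every such labelled tree comes from an immersed disk. Near a piece of the diagram the
immersion looks as follows.
* Crossing: an end of an interval on one of the two strands either follows its strand through the
  crossing or turns at the crossing, with a convex corner in the top quadrant (lower end) or in the
  bottom quadrant (upper end); these corners are negative. An interval which opens in the right
  quadrant or closes in the left quadrant has its convex corner at a positive quadrant.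
* Left extremum: an interval may open there (the disk lies inside), pass, or split into two, when the
  boundary of the disk wraps around the extremum from outside.
* Right extremum: an interval may close there, pass, or two intervals may merge into one. -/

/-- `LowerStep p c b b' w`: the lower end of an interval is on strand `b` to the left of the crossing
`c` of the strands `p` and `p + 1`, and on strand `b'` to the right of it; `w` is the word that it
contributes. -/
inductive LowerStep {R : Type} (T : Type) (p : ℕ) (c : R) : ℕ → ℕ → CEWord R T → Prop
  | away (x : ℕ) : x ≠ p → x ≠ p + 1 → LowerStep T p c x x 1
  | descend : LowerStep T p c p (p + 1) 1
  | ascend : LowerStep T p c (p + 1) p 1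
  | corner : LowerStep T p c p p (chordWord T c)

/-- The same as `LowerStep`, for the upper end of an interval. -/
inductive UpperStep {R : Type} (T : Type) (p : ℕ) (c : R) : ℕ → ℕ → CEWord R T → Prop
  | away (x : ℕ) : x ≠ p → x ≠ p + 1 → UpperStep T p c x x 1
  | descend : UpperStep T p c p (p + 1) 1
  | ascend : UpperStep T p c (p + 1) p 1
  | corner : UpperStep T p c (p + 1) (p + 1) (chordWord T c)

/-- The number that strand `x` gets when two new strands `p` and `p + 1` are inserted. -/
def strandShift (p x : ℕ) : ℕ := if x < p then x else x + 2

/-- The two directions in which a disk can be followed from an interval. -/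
inductive Side : Type
  | leftward
  | rightward

open DiagramPiece Side in
/-- `DiskPart D σ s a b` is the type of all parts of immersed disks that lie beyond an interval in
slab `s` with upper end on strand `a` and lower end on strand `b`, in the direction `σ`, and that
have no positive corner: the rooted trees of intervals described above, branch by branch. -/
inductive DiskPart {R T : Type} (D : LagrangianDiagram R T) : Side → ℕ → ℕ → ℕ → Type
  /-- Going left, the interval ends at a left extremum. -/
  | leftEnd {s p a b : ℕ} (h : D[s]? = some (left p)) (ha : a = p) (hb : b = p + 1) :
      DiskPart D leftward (s + 1) a b
  /-- Going left, the interval passes a left extremum. -/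
  | leftPassLeft {s p a b a' b' : ℕ} (h : D[s]? = some (left p)) (hab : a < b)
      (ha : a' = strandShift p a) (hb : b' = strandShift p b) (u : DiskPart D leftward s a b) :
      DiskPart D leftward (s + 1) a' b'
  /-- Going left, the interval is the upper branch of a splitting. -/
  | leftSplitUpper {s p a b a' b' : ℕ} (h : D[s]? = some (left p)) (hap : a < p) (hpb : p ≤ b)
      (ha : a' = strandShift p a) (hb : b' = p)
      (u : DiskPart D leftward s a b) (v : DiskPart D rightward (s + 1) (p + 1) (strandShift p b)) :
      DiskPart D leftward (s + 1) a' b'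
  /-- Going left, the interval is the lower branch of a splitting. -/
  | leftSplitLower {s p a b a' b' : ℕ} (h : D[s]? = some (left p)) (hap : a < p) (hpb : p ≤ b)
      (ha : a' = p + 1) (hb : b' = strandShift p b)
      (u : DiskPart D leftward s a b) (v : DiskPart D rightward (s + 1) (strandShift p a) p) :
      DiskPart D leftward (s + 1) a' b'
  /-- Going left, the interval passes a crossing. -/
  | leftPassCross {s p a b a' b' : ℕ} {c : R} {x y : CEWord R T} (h : D[s]? = some (cross p c))
      (hab : a < b) (hab' : a' < b') (ha : UpperStep T p c a a' x) (hb : LowerStep T p c b b' y)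
      (u : DiskPart D leftward s a b) : DiskPart D leftward (s + 1) a' b'
  /-- Going left, the interval passes a right extremum. -/
  | leftPassRight {s p a b : ℕ} {t : T} (h : D[s]? = some (right p t)) (hab : a < b)
      (u : DiskPart D leftward s (strandShift p a) (strandShift p b)) :
      DiskPart D leftward (s + 1) a b
  /-- Going left, the interval arises by merging two intervals. -/
  | leftMerge {s p a b : ℕ} {t : T} (h : D[s]? = some (right p t)) (hap : a < p) (hpb : p ≤ b)
      (u : DiskPart D leftward s (strandShift p a) p)
      (v : DiskPart D leftward s (p + 1) (strandShift p b)) :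
      DiskPart D leftward (s + 1) a b
  /-- Going right, the interval ends at a right extremum. -/
  | rightEnd {s p a b : ℕ} {t : T} (h : D[s]? = some (right p t)) (ha : a = p) (hb : b = p + 1) :
      DiskPart D rightward s a b
  /-- Going right, the interval passes a right extremum. -/
  | rightPassRight {s p a b a' b' : ℕ} {t : T} (h : D[s]? = some (right p t)) (hab : a' < b')
      (ha : a = strandShift p a') (hb : b = strandShift p b')
      (u : DiskPart D rightward (s + 1) a' b') : DiskPart D rightward s a b
  /-- Going right, the interval is the upper one of two merging intervals. -/
  | rightMergeUpper {s p a b a' b' : ℕ} {t : T} (h : D[s]? = some (right p t)) (hap : a' < p)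
      (hpb : p ≤ b') (ha : a = strandShift p a') (hb : b = p)
      (u : DiskPart D rightward (s + 1) a' b')
      (v : DiskPart D leftward s (p + 1) (strandShift p b')) : DiskPart D rightward s a b
  /-- Going right, the interval is the lower one of two merging intervals. -/
  | rightMergeLower {s p a b a' b' : ℕ} {t : T} (h : D[s]? = some (right p t)) (hap : a' < p)
      (hpb : p ≤ b') (ha : a = p + 1) (hb : b = strandShift p b')
      (u : DiskPart D rightward (s + 1) a' b')
      (v : DiskPart D leftward s (strandShift p a') p) : DiskPart D rightward s a b
  /-- Going right, the interval passes a crossing. -/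
  | rightPassCross {s p a b a' b' : ℕ} {c : R} {x y : CEWord R T} (h : D[s]? = some (cross p c))
      (hab : a < b) (hab' : a' < b') (ha : UpperStep T p c a a' x) (hb : LowerStep T p c b b' y)
      (u : DiskPart D rightward (s + 1) a' b') : DiskPart D rightward s a b
  /-- Going right, the interval passes a left extremum. -/
  | rightPassLeft {s p a b : ℕ} (h : D[s]? = some (left p)) (hab : a < b)
      (u : DiskPart D rightward (s + 1) (strandShift p a) (strandShift p b)) :
      DiskPart D rightward s a b
  /-- Going right, the interval splits into two at a left extremum. -/
  | rightSplit {s p a b : ℕ} (h : D[s]? = some (left p)) (hap : a < p) (hpb : p ≤ b)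
      (u : DiskPart D rightward (s + 1) (strandShift p a) p)
      (v : DiskPart D rightward (s + 1) (p + 1) (strandShift p b)) : DiskPart D rightward s a b

/-- The word read along the boundary of a part of a disk, counterclockwise: from the upper end to the
lower end of the interval for a part on the left of the interval, and from the lower end to the upper
end for a part on the right of it. A negative corner contributes its chord. A marked point
contributes `t` if the boundary passes it in the direction of the link (wrapping around a right
extremum from outside), and `t⁻¹` if it passes it in the opposite direction (closing at a right
extremum). -/
def DiskPart.word {R T : Type} {D : LagrangianDiagram R T} {σ : Side} {s a b : ℕ} :
    DiskPart D σ s a b → CEWord R T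
  | .leftEnd _ _ _ => 1
  | .leftPassLeft _ _ _ _ u => u.word
  | .leftSplitUpper _ _ _ _ _ u v => u.word * v.word
  | .leftSplitLower _ _ _ _ _ u v => v.word * u.word
  | .leftPassCross (x := x) (y := y) _ _ _ _ _ u => x * u.word * y
  | .leftPassRight _ _ u => u.word
  | .leftMerge (t := t) _ _ _ u v => u.word * markWord R (FreeGroup.of t) * v.word
  | .rightEnd (t := t) _ _ _ => markWord R (FreeGroup.of t)⁻¹
  | .rightPassRight _ _ _ _ u => u.word
  | .rightMergeUpper (t := t) _ _ _ _ _ u v => markWord R (FreeGroup.of t) * v.word * u.word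
  | .rightMergeLower (t := t) _ _ _ _ _ u v => u.word * v.word * markWord R (FreeGroup.of t)
  | .rightPassCross (x := x) (y := y) _ _ _ _ _ u => y * u.word * x
  | .rightPassLeft _ _ u => u.word
  | .rightSplit _ _ _ u v => v.word * u.word

open DiagramPiece Side in
/-- The immersed disks, up to reparametrization, whose only positive corner is at the Reeb chord `c`;
the positive corner lies in the left or in the right quadrant of the crossing. -/
inductive ImmersedDisk {R T : Type} (D : LagrangianDiagram R T) (c : R) : Type
  | atLeftQuadrant (s p : ℕ) (h : D[s]? = some (cross p c)) (u : DiskPart D leftward s p (p + 1))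
  | atRightQuadrant (s p : ℕ) (h : D[s]? = some (cross p c))
      (u : DiskPart D rightward (s + 1) p (p + 1))

/-- The word of an immersed disk, read counterclockwise along its boundary from the positive
corner. -/
def ImmersedDisk.word {R T : Type} {D : LagrangianDiagram R T} {c : R} :
    ImmersedDisk D c → CEWord R T
  | .atLeftQuadrant _ _ _ u => u.word
  | .atRightQuadrant _ _ _ u => u.word

/-! ## The fully non-commutative Chekanov-Eliashberg dga -/

/-- The algebra freely generated over `ℤ/2` by the Reeb chords and by the invertible formal variables
of the marked points. -/
abbrev CEAlgebra (R T : Type) : Type := MonoidAlgebra (ZMod 2) (CEWord R T)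

/-- A word as an element of the algebra. -/
noncomputable def wordElt {R T : Type} (w : CEWord R T) : CEAlgebra R T :=
  MonoidAlgebra.of (ZMod 2) (CEWord R T) w

/-- The differential of a Reeb chord: the sum of the words of all immersed disks with positive corner
at it. -/
noncomputable def chordDifferential {R T : Type} (D : LagrangianDiagram R T) (c : R) :
    CEAlgebra R T :=
  ∑ᶠ u : ImmersedDisk D c, wordElt u.word

/-- The algebra homomorphism `x ↦ x + ∂x ε` (where `ε² = 0`) that encodes the extension of the
differential from the generators by the Leibniz rule. -/
noncomputable def leibnizExtension {R T : Type} (D : LagrangianDiagram R T) :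
    CEAlgebra R T →ₐ[ZMod 2] TrivSqZeroExt (CEAlgebra R T) (CEAlgebra R T) :=
  MonoidAlgebra.lift (ZMod 2) (TrivSqZeroExt (CEAlgebra R T) (CEAlgebra R T)) (CEWord R T)
    (Monoid.Coprod.lift
      (FreeMonoid.lift fun c =>
        TrivSqZeroExt.inl (wordElt (chordWord T c)) + TrivSqZeroExt.inr (chordDifferential D c))
      ((TrivSqZeroExt.inlHom (CEAlgebra R T) (CEAlgebra R T)).toMonoidHom.comp
        ((MonoidAlgebra.of (ZMod 2) (CEWord R T)).comp Monoid.Coprod.inr)))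

/-- The differential of the dga of a Lagrangian diagram. -/
noncomputable def ceDifferential {R T : Type} (D : LagrangianDiagram R T) :
    CEAlgebra R T →ₗ[ZMod 2] CEAlgebra R T :=
  (TrivSqZeroExt.sndHom (CEAlgebra R T) (CEAlgebra R T)).restrictScalars (ZMod 2) ∘ₗ
    (leibnizExtension D).toLinearMap

theorem ceDifferential_chord {R T : Type} (D : LagrangianDiagram R T) (c : R) :
    ceDifferential D (wordElt (chordWord T c)) = chordDifferential D c := by
  simp [ceDifferential, leibnizExtension, wordElt, chordWord]

theorem ceDifferential_mark {R T : Type} (D : LagrangianDiagram R T) (t : FreeGroup T) :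
    ceDifferential D (wordElt (markWord R t)) = 0 := by
  simp [ceDifferential, leibnizExtension, wordElt, markWord]

theorem leibnizExtension_fst {R T : Type} (D : LagrangianDiagram R T) (x : CEAlgebra R T) :
    (leibnizExtension D x).fst = x := by
  have h : (TrivSqZeroExt.fstHom (ZMod 2) (CEAlgebra R T) (CEAlgebra R T)).comp
      (leibnizExtension D) = AlgHom.id (ZMod 2) (CEAlgebra R T) := by
    apply MonoidAlgebra.algHom_ext'
    rotate_left
    · exact Subsingleton.elim _ _
    apply Monoid.Coprod.hom_ext (M := FreeMonoid R) (N := FreeGroup T)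
    · apply FreeMonoid.hom_eq
      intro c
      simp [leibnizExtension, wordElt, chordWord]
    · ext1 t
      simp [leibnizExtension]
  exact DFunLike.congr_fun h x

theorem ceDifferential_mul {R T : Type} (D : LagrangianDiagram R T) (x y : CEAlgebra R T) :
    ceDifferential D (x * y) = ceDifferential D x * y + x * ceDifferential D y := by
  simp [ceDifferential, leibnizExtension_fst, add_comm]

/-- The degree of a word, for given degrees of the Reeb chords; formal variables have degree `0`. -/
def wordDegree {R T : Type} (deg : R → ℤ) : CEWord R T →* Multiplicative ℤ :=
  Monoid.Coprod.lift (FreeMonoid.lift fun c => Multiplicative.ofAdd (deg c)) 1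

/-- An augmentation of the dga of the diagram `D`, with chords graded by `deg`, with values in a ring
`S`: a unital dga homomorphism to `(S, 0)`, where `S` is placed in degree `0`. (A unital ring
homomorphism is automatically `ℤ/2`-linear.) -/
structure Augmentation {R T : Type} (D : LagrangianDiagram R T) (deg : R → ℤ)
    (S : Type*) [CommRing S] where
  toRingHom : CEAlgebra R T →+* S
  map_differential : ∀ x, toRingHom (ceDifferential D x) = 0
  map_of_degree_ne : ∀ w : CEWord R T, wordDegree deg w ≠ 1 → toRingHom (wordElt w) = 0

/-- The image of an augmentation under a change of the target ring. -/
noncomputable def Augmentation.map {R T : Type} {D : LagrangianDiagram R T} {deg : R → ℤ}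
    {S S' : Type*} [CommRing S] [CommRing S'] (g : S →+* S') (ε : Augmentation D deg S) :
    Augmentation D deg S' where
  toRingHom := g.comp ε.toRingHom
  map_differential x := by simp [ε.map_differential x]
  map_of_degree_ne w hw := by simp [ε.map_of_degree_ne w hw]

/-! ## Positive braid Legendrian links -/

/-- The Lagrangian projection of the rainbow closure of the positive braid word `i` on `n` strands,
after Ng's resolution. Letters are counted from `0`: the letter `i k` stands for the crossing of the
braid strands `i k` and `i k + 1`, counted from `0` and from top to bottom. The Reeb chords are the
braid crossings `b k = Sum.inl k` and the crossings `a k = Sum.inr k` at the right cusps.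
First come `n` nested left extrema; then, below the upper `n` strands, the braid; then, from the
innermost to the outermost, the resolved right cusps, each a crossing followed by a right extremum
with a marked point. -/
def rainbowClosure {n l : ℕ} (i : Fin l → Fin (n - 1)) :
    LagrangianDiagram (Fin l ⊕ Fin n) (Fin n) :=
  List.ofFn (fun k : Fin n => DiagramPiece.left (k : ℕ)) ++
    List.ofFn (fun k : Fin l => DiagramPiece.cross (n + (i k : ℕ)) (Sum.inl k)) ++
    (List.ofFn fun k : Fin n =>
      [DiagramPiece.cross (n - 1 - (k : ℕ)) (Sum.inr k),
        DiagramPiece.right (n - 1 - (k : ℕ)) k]).flatten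

/-- The degrees of the Reeb chords for the binary Maslov potential (`1` on the upper strands and `0`
on the lower strands): a crossing of the braid has degree `0`, a right cusp has degree `1`. -/
def rainbowDegree {n l : ℕ} : Fin l ⊕ Fin n → ℤ := Sum.elim (fun _ => 0) (fun _ => 1)

/-- The set of `S`-valued points of the augmentation variety of the link of the positive braid word
`i`: the augmentations of its dga with values in `S`. -/
abbrev BraidAug {n l : ℕ} (i : Fin l → Fin (n - 1)) (S : Type*) [CommRing S] :=
  Augmentation (rainbowClosure i) rainbowDegree S

/-- The Reeb coordinate `b k` of an augmentation. -/
noncomputable def BraidAug.b {n l : ℕ} {i : Fin l → Fin (n - 1)} {S : Type*} [CommRing S]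
    (ε : BraidAug i S) (k : Fin l) : S :=
  ε.toRingHom (wordElt (chordWord (Fin n) (Sum.inl k)))

/-- The value of an augmentation at the formal variable `t j`. -/
noncomputable def BraidAug.t {n l : ℕ} {i : Fin l → Fin (n - 1)} {S : Type*} [CommRing S]
    (ε : BraidAug i S) (j : Fin n) : S :=
  ε.toRingHom (wordElt (markWord (Fin l ⊕ Fin n) (FreeGroup.of j)))

/-! ## The matrix of a braid word and the coordinate ring -/

/-- The `n × n` matrix `Z_i(b)`: the identity matrix, except for the block with rows `b, 1` and
`1, 0` in the rows and columns `i` and `i + 1` (counted from `0`). -/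
def braidZ {n : ℕ} {S : Type*} [CommRing S] (i : Fin (n - 1)) (b : S) :
    Matrix (Fin n) (Fin n) S :=
  Matrix.of fun r c =>
    if (r : ℕ) = i ∧ (c : ℕ) = i then b
    else if (r : ℕ) = i ∧ (c : ℕ) = i + 1 then 1
    else if (r : ℕ) = i + 1 ∧ (c : ℕ) = i then 1
    else if (r : ℕ) = i + 1 ∧ (c : ℕ) = i + 1 then 0
    else if r = c then 1 else 0

/-- The matrix `Z_{i_1}(b_1) ⋯ Z_{i_l}(b_l)`. -/
def braidMatrix {n l : ℕ} {S : Type*} [CommRing S] (i : Fin l → Fin (n - 1)) (b : Fin l → S) :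
    Matrix (Fin n) (Fin n) S :=
  (List.ofFn fun k : Fin l => braidZ (i k) (b k)).prod

/-- The principal minor `Δ_{m+1}(N)`, for `m = 0, …, n - 1`: the determinant of the submatrix formed
by the first `m + 1` rows and columns. -/
def principalMinor {n : ℕ} {S : Type*} [CommRing S] (N : Matrix (Fin n) (Fin n) S) (m : Fin n) : S :=
  (N.submatrix (Fin.castLE (Nat.succ_le_of_lt m.isLt))
    (Fin.castLE (Nat.succ_le_of_lt m.isLt))).det

/-- The polynomial `∏_m Δ_m(M)` in the Reeb coordinates. -/
noncomputable def minorProduct (F : Type*) [CommRing F] {n l : ℕ} (i : Fin l → Fin (n - 1)) :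
    MvPolynomial (Fin l) F :=
  ∏ m : Fin n, principalMinor (braidMatrix i fun k => MvPolynomial.X k) m

/-- The ring `F[b_1, …, b_l, t_1^{±1}, …, t_n^{±1}]`. -/
abbrev MixedLaurent (F : Type*) [CommRing F] (l n : ℕ) : Type _ :=
  AddMonoidAlgebra F ((Fin l →₀ ℕ) × (Fin n →₀ ℤ))

/-- The variable `b_k`. -/
noncomputable def MixedLaurent.b (F : Type*) [CommRing F] {l : ℕ} (n : ℕ) (k : Fin l) :
    MixedLaurent F l n :=
  AddMonoidAlgebra.single (Finsupp.single k 1, 0) 1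

/-- The monomial `t_j ^ z`. -/
noncomputable def MixedLaurent.t (F : Type*) [CommRing F] (l : ℕ) {n : ℕ} (j : Fin n) (z : ℤ) :
    MixedLaurent F l n :=
  AddMonoidAlgebra.single (0, Finsupp.single j z) 1

/-- The ideal generated by `Δ_m(M) - ∏_{k ≤ m} t_k⁻¹` for `1 ≤ m ≤ n`. -/
noncomputable def minorIdeal (F : Type*) [CommRing F] {n l : ℕ} (i : Fin l → Fin (n - 1)) :
    Ideal (MixedLaurent F l n) :=
  Ideal.span (Set.range fun m : Fin n =>
    principalMinor (braidMatrix i fun k => MixedLaurent.b F n k) m -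
      ∏ k ∈ Finset.Iic m, MixedLaurent.t F l k (-1))

/-- The quotient of `F[b_1, …, b_l, t_1^{±1}, …, t_n^{±1}]` by that ideal. -/
abbrev MinorRing (F : Type*) [CommRing F] {n l : ℕ} (i : Fin l → Fin (n - 1)) : Type _ :=
  MixedLaurent F l n ⧸ minorIdeal F i

/-- The class of `b_k`. -/
noncomputable def MinorRing.b (F : Type*) [CommRing F] {n l : ℕ} (i : Fin l → Fin (n - 1))
    (k : Fin l) : MinorRing F i :=
  Ideal.Quotient.mk (minorIdeal F i) (MixedLaurent.b F n k)

/-- The class of `t_j`. -/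
noncomputable def MinorRing.t (F : Type*) [CommRing F] {n l : ℕ} (i : Fin l → Fin (n - 1))
    (j : Fin n) : MinorRing F i :=
  Ideal.Quotient.mk (minorIdeal F i) (MixedLaurent.t F l j 1)

/-- The morphism `Spec (F[b, t^{±1}] / I) ⟶ Spec F[b_1, …, b_l]` given by the Reeb coordinates. -/
noncomputable def reebCoordinates (F : Type*) [CommRing F] {n l : ℕ} (i : Fin l → Fin (n - 1)) :
    Spec (CommRingCat.of (MinorRing F i)) ⟶ Spec (CommRingCat.of (MvPolynomial (Fin l) F)) :=
  Spec.map (CommRingCat.ofHom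
    (MvPolynomial.aeval (R := F) (fun k => MinorRing.b F i k)).toRingHom)

/-!
The augmentation variety is computed from an explicit count of disks.

*Which disks occur.* For a Maslov potential `μ`, the degree of the boundary word of a part of a disk
cut off along an interval is determined by the values of `μ` at the two ends of the interval
(`IsMaslovPotential.wordDegree_word`). All Reeb chords of the rainbow closure have degree at least
`0`, so a part on the left of an interval has its upper end on an upper strand (`μ = 1`) and its
lower end on a lower strand (`μ = 0`), and it has no corner at a right cusp. Parts on the right of
an interval occur only behind the crossing of a right cusp. Consequently no disk has its positive
corner at a crossing of the braid (`isEmpty_immersedDisk_braid`), and the disks at a right cusp are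
the lobe of the cusp, with word `t_k⁻¹`, and parts on the left of the crossing.

*Counting them.* The sums of the words of the parts on the left of an interval, evaluated in a
commutative ring, obey a recursion from slab to slab. Left cusps produce the identity matrix, a
braid crossing multiplies by `Z_i(b)` on the right (`hasLeftSum_braid`), and passing the `k`-th right
cusp replaces the matrix `A` by `A + A_{• k} t_k A_{k •}`, where the second summand comes from the
disks that wrap around the extremum (`hasLeftSum_cusps`). The differential of the `k`-th cusp
is therefore `A_{kk} + t_k⁻¹`, with `A` the matrix after `k` updates.

*Minors.* If `A_{kk} = t_k⁻¹`, then in characteristic two the update is the step of Gaussian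
elimination for the pivot `A_{kk}`. So all differentials are killed if and only if the pivots of
`M` are the `t_k⁻¹`, that is, if and only if `Δ_m(M) = ∏_{k ≤ m} t_k⁻¹` for all `m`
(`cuspIterate_eq_iff_diagonalMinor_eq`, `map_chordDifferential_cusp_iff`).

*The open subset.* These equations can be solved for `t` exactly where all `Δ_m(M)` are units, and
then uniquely. Hence the coordinate ring is the localization of the polynomial ring in the `b_k` at
`∏_m Δ_m(M)` (`MinorRing.isLocalization_away`).
-/

/-! ### Finite weighted sums -/

/-- The weight `w` has total `x`: the index type is finite and the weights add up to `x`. -/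
structure HasTotal {ι S : Type*} [Semiring S] (w : ι → S) (x : S) : Prop where
  finite : Finite ι
  finsum_eq : ∑ᶠ i, w i = x

namespace HasTotal

variable {ι κ S : Type*} [Semiring S]

theorem of_bijective {w : ι → S} {v : κ → S} {x : S} (h : HasTotal w x) (f : ι → κ)
    (hf : Function.Bijective f) (hv : ∀ i, v (f i) = w i) : HasTotal v x := by
  have := h.finite
  refine ⟨Finite.of_surjective f hf.2, ?_⟩
  rw [← h.finsum_eq]
  exact (finsum_eq_of_bijective f hf fun i => (hv i).symm).symm

theorem of_isEmpty [IsEmpty ι] (w : ι → S) : HasTotal w 0 :=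
  ⟨inferInstance, finsum_of_isEmpty w⟩

theorem punit (w : Unit → S) : HasTotal w (w ()) :=
  ⟨inferInstance, finsum_unique w⟩

theorem sum {w : ι → S} {v : κ → S} {x y : S} (h : HasTotal w x) (h' : HasTotal v y) :
    HasTotal (Sum.elim w v) (x + y) := by
  have := h.finite
  have := h'.finite
  refine ⟨inferInstance, ?_⟩
  have := Fintype.ofFinite ι
  have := Fintype.ofFinite κ
  rw [← h.finsum_eq, ← h'.finsum_eq]
  simp [finsum_eq_sum_of_fintype]

theorem prod {w : ι → S} {v : κ → S} {x y : S} (h : HasTotal w x) (h' : HasTotal v y) :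
    HasTotal (fun q : ι × κ => w q.1 * v q.2) (x * y) := by
  have := h.finite
  have := h'.finite
  refine ⟨inferInstance, ?_⟩
  have := Fintype.ofFinite ι
  have := Fintype.ofFinite κ
  rw [← h.finsum_eq, ← h'.finsum_eq]
  simp [finsum_eq_sum_of_fintype, Fintype.sum_mul_sum, Fintype.sum_prod_type]

theorem mul_right {w : ι → S} {x : S} (h : HasTotal w x) (c : S) :
    HasTotal (fun i => w i * c) (x * c) := by
  have := h.finite
  refine ⟨inferInstance, ?_⟩
  have := Fintype.ofFinite ι
  rw [← h.finsum_eq]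
  simp [finsum_eq_sum_of_fintype, Finset.sum_mul]

end HasTotal

/-! ### Maslov potentials and the degree of a disk -/

theorem strandShift_strictMono (p : ℕ) : StrictMono (strandShift p) := by
  intro x y h
  unfold strandShift
  split_ifs <;> omega

theorem strandShift_ne (p x : ℕ) : strandShift p x ≠ p ∧ strandShift p x ≠ p + 1 := by
  unfold strandShift
  split_ifs <;> omega

theorem strandShift_of_lt {p x : ℕ} (h : x < p) : strandShift p x = x := by
  simp [strandShift, h]

theorem strandShift_of_le {p x : ℕ} (h : p ≤ x) : strandShift p x = x + 2 := by
  simp [strandShift, h]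

/-- The upper end of an interval lies above its lower end. -/
theorem DiskPart.lt {R T : Type} {D : LagrangianDiagram R T} {σ : Side} {s a b : ℕ}
    (u : DiskPart D σ s a b) : a < b := by
  cases u with
  | leftPassLeft h hab ha hb u => subst ha hb; exact strandShift_strictMono _ hab
  | rightPassRight h hab ha hb u => subst ha hb; exact strandShift_strictMono _ hab
  | leftSplitUpper h hap hpb ha hb u v => rw [ha, hb, strandShift_of_lt hap]; exact hap
  | leftSplitLower h hap hpb ha hb u v => rw [ha, hb, strandShift_of_le hpb]; omega
  | rightMergeUpper h hap hpb ha hb u v => rw [ha, hb, strandShift_of_lt hap]; exact hap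
  | rightMergeLower h hap hpb ha hb u v => rw [ha, hb, strandShift_of_le hpb]; omega
  | _ => omega

/-- A Maslov potential `μ` on the strands of each slab (`μ s x` is its value at the strand `x` of
slab `s`) that induces the grading `deg` of the Reeb chords. The orientation of the link plays no
role, so that at a right extremum, where the front cusp has been resolved into a crossing followed
by the extremum, the lower strand has the larger potential. -/
structure IsMaslovPotential {R T : Type} (D : LagrangianDiagram R T) (deg : R → ℤ)
    (μ : ℕ → ℕ → ℤ) : Prop where
  left_new {s p : ℕ} : D[s]? = some (.left p) → μ (s + 1) p = μ (s + 1) (p + 1) + 1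
  left_old {s p : ℕ} : D[s]? = some (.left p) → ∀ x, μ (s + 1) (strandShift p x) = μ s x
  right_new {s p : ℕ} {t : T} : D[s]? = some (.right p t) → μ s (p + 1) = μ s p + 1
  right_old {s p : ℕ} {t : T} : D[s]? = some (.right p t) → ∀ x, μ s (strandShift p x) = μ (s + 1) x
  cross_deg {s p : ℕ} {c : R} : D[s]? = some (.cross p c) → deg c = μ s p - μ s (p + 1)
  cross_descend {s p : ℕ} {c : R} : D[s]? = some (.cross p c) → μ (s + 1) (p + 1) = μ s p
  cross_ascend {s p : ℕ} {c : R} : D[s]? = some (.cross p c) → μ (s + 1) p = μ s (p + 1)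
  cross_away {s p : ℕ} {c : R} : D[s]? = some (.cross p c) →
    ∀ x, x ≠ p → x ≠ p + 1 → μ (s + 1) x = μ s x

section Degree

variable {R T : Type} {D : LagrangianDiagram R T} {deg : R → ℤ} {μ : ℕ → ℕ → ℤ}

theorem wordDegree_chord (c : R) :
    (wordDegree deg (chordWord T c)).toAdd = deg c := by
  simp [wordDegree, chordWord]

theorem wordDegree_mark (t : FreeGroup T) : wordDegree deg (markWord R t) = 1 := by
  simp [wordDegree, markWord]

theorem wordDegree_nonneg (hdeg : ∀ c, 0 ≤ deg c) (w : CEWord R T) :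
    0 ≤ (wordDegree deg w).toAdd := by
  induction w using Monoid.Coprod.induction_on with
  | inl m =>
    induction m using FreeMonoid.inductionOn with
    | one => simp
    | of c => exact (wordDegree_chord (T := T) (deg := deg) c).symm ▸ hdeg c
    | mul x y hx hy => simp only [map_mul, toAdd_mul]; exact add_nonneg hx hy
  | inr t => exact le_of_eq (by simp [wordDegree])
  | mul x y hx hy => simp only [map_mul, toAdd_mul]; exact add_nonneg hx hy

theorem IsMaslovPotential.upperStep (hμ : IsMaslovPotential D deg μ) {s p a a' : ℕ} {c : R}
    {x : CEWord R T} (h : D[s]? = some (.cross p c)) (ha : UpperStep T p c a a' x) :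
    (wordDegree deg x).toAdd = μ (s + 1) a' - μ s a := by
  have h1 := hμ.cross_deg h
  have h2 := hμ.cross_descend h
  have h3 := hμ.cross_ascend h
  cases ha with
  | away _ hp hp' => simp [hμ.cross_away h _ hp hp']
  | descend => simp [h2]
  | ascend => simp [h3]
  | corner => rw [wordDegree_chord]; omega

theorem IsMaslovPotential.lowerStep (hμ : IsMaslovPotential D deg μ) {s p b b' : ℕ} {c : R}
    {y : CEWord R T} (h : D[s]? = some (.cross p c)) (hb : LowerStep T p c b b' y) :
    (wordDegree deg y).toAdd = μ s b - μ (s + 1) b' := by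
  have h1 := hμ.cross_deg h
  have h2 := hμ.cross_descend h
  have h3 := hμ.cross_ascend h
  cases hb with
  | away _ hp hp' => simp [hμ.cross_away h _ hp hp']
  | descend => simp [h2]
  | ascend => simp [h3]
  | corner => rw [wordDegree_chord]; omega

/-- The index formula: the degree of the boundary word of a part of a disk is determined by the
potentials at the two ends of the interval where the part has been cut off. -/
theorem IsMaslovPotential.wordDegree_word (hμ : IsMaslovPotential D deg μ) {σ : Side} {s a b : ℕ}
    (u : DiskPart D σ s a b) :
    (wordDegree deg u.word).toAdd =
      match σ with
      | .leftward => μ s a - μ s b - 1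
      | .rightward => μ s b - μ s a - 1 := by
  induction u with
  | leftEnd h ha hb =>
    subst ha hb
    have := hμ.left_new h
    simp only [DiskPart.word, map_one, toAdd_one]
    omega
  | leftPassLeft h hab ha hb u ih =>
    subst ha hb
    simp only [DiskPart.word, hμ.left_old h]
    exact ih
  | leftSplitUpper h hap hpb ha hb u v ihu ihv =>
    subst ha hb
    have := hμ.left_new h
    simp only [hμ.left_old h] at ihv
    simp only [DiskPart.word, hμ.left_old h, map_mul, toAdd_mul, ihu, ihv]
    omega
  | leftSplitLower h hap hpb ha hb u v ihu ihv =>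
    subst ha hb
    have := hμ.left_new h
    simp only [hμ.left_old h] at ihv
    simp only [DiskPart.word, hμ.left_old h, map_mul, toAdd_mul, ihu, ihv]
    omega
  | leftPassCross h hab hab' ha hb u ih =>
    have h1 := hμ.upperStep h ha
    have h2 := hμ.lowerStep h hb
    simp only [DiskPart.word, map_mul, toAdd_mul, h1, h2, ih]
    omega
  | leftPassRight h hab u ih =>
    simp only [hμ.right_old h] at ih
    exact ih
  | leftMerge h hap hpb u v ihu ihv =>
    have := hμ.right_new h
    simp only [hμ.right_old h] at ihu ihv
    simp only [DiskPart.word, map_mul, toAdd_mul, ihu, ihv, wordDegree_mark, toAdd_one]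
    omega
  | rightEnd h ha hb =>
    subst ha hb
    have := hμ.right_new h
    simp only [DiskPart.word, wordDegree_mark, toAdd_one]
    omega
  | rightPassRight h hab ha hb u ih =>
    subst ha hb
    simp only [DiskPart.word, hμ.right_old h]
    exact ih
  | rightMergeUpper h hap hpb ha hb u v ihu ihv =>
    subst ha hb
    have := hμ.right_new h
    simp only [hμ.right_old h] at ihv
    simp only [DiskPart.word, hμ.right_old h, map_mul, toAdd_mul, ihu, ihv, wordDegree_mark,
      toAdd_one]
    omega
  | rightMergeLower h hap hpb ha hb u v ihu ihv =>
    subst ha hb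
    have := hμ.right_new h
    simp only [hμ.right_old h] at ihv
    simp only [DiskPart.word, hμ.right_old h, map_mul, toAdd_mul, ihu, ihv, wordDegree_mark,
      toAdd_one]
    omega
  | rightPassCross h hab hab' ha hb u ih =>
    have h1 := hμ.upperStep h ha
    have h2 := hμ.lowerStep h hb
    simp only [DiskPart.word, map_mul, toAdd_mul, h1, h2, ih]
    omega
  | rightPassLeft h hab u ih =>
    simp only [hμ.left_old h] at ih
    exact ih
  | rightSplit h hap hpb u v ihu ihv =>
    have := hμ.left_new h
    simp only [hμ.left_old h] at ihu ihv
    simp only [DiskPart.word, map_mul, toAdd_mul, ihu, ihv]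
    omega

theorem IsMaslovPotential.lt_of_leftward (hμ : IsMaslovPotential D deg μ) (hdeg : ∀ c, 0 ≤ deg c)
    {s a b : ℕ} (u : DiskPart D .leftward s a b) : μ s b < μ s a := by
  have h1 := wordDegree_nonneg hdeg u.word
  have h2 := hμ.wordDegree_word u
  simp only at h2
  omega

theorem IsMaslovPotential.lt_of_rightward (hμ : IsMaslovPotential D deg μ)
    (hdeg : ∀ c, 0 ≤ deg c) {s a b : ℕ} (u : DiskPart D .rightward s a b) : μ s a < μ s b := by
  have h1 := wordDegree_nonneg hdeg u.word
  have h2 := hμ.wordDegree_word u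
  simp only at h2
  omega

end Degree

/-! ### Sums over the parts of disks on the left of an interval -/

section Recursion

variable {R T : Type} {D : LagrangianDiagram R T} {S : Type*} [Semiring S] (φ : CEWord R T →* S)

variable (D) in
/-- There are finitely many parts of disks on the left of the interval from the strand `a` to the
strand `b` of slab `s`, and the values of `φ` at their words add up to `x`. -/
def HasLeftSum (s a b : ℕ) (x : S) : Prop :=
  HasTotal (fun u : DiskPart D .leftward s a b => φ u.word) x

variable {φ}

theorem HasLeftSum.of_isEmpty {s a b : ℕ} (h : IsEmpty (DiskPart D .leftward s a b)) :
    HasLeftSum D φ s a b 0 :=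
  HasTotal.of_isEmpty _

theorem hasLeftSum_zero (a b : ℕ) : HasLeftSum D φ 0 a b 0 :=
  .of_isEmpty ⟨fun u => nomatch u⟩

theorem hasLeftSum_leftEnd {s p : ℕ} (h : D[s]? = some (.left p)) :
    HasLeftSum D φ (s + 1) p (p + 1) 1 := by
  refine (HasTotal.punit fun _ => (1 : S)).of_bijective (fun _ => .leftEnd h rfl rfl)
    ⟨fun _ _ _ => rfl, fun u => ⟨(), ?_⟩⟩ (fun _ => by simp [DiskPart.word])
  cases u with
  | leftEnd h' ha hb => subst ha; rfl
  | leftPassLeft h' hab ha hb u =>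
    obtain rfl : p = _ := by simpa using h.symm.trans h'
    exact absurd ha.symm (strandShift_ne _ _).1
  | leftSplitUpper h' hap hpb ha hb u v =>
    obtain rfl : p = _ := by simpa using h.symm.trans h'
    exact absurd ha.symm (strandShift_ne _ _).1
  | leftSplitLower h' hap hpb ha hb u v =>
    obtain rfl : p = _ := by simpa using h.symm.trans h'
    omega
  | leftPassCross h' => simp [h] at h'
  | leftPassRight h' => simp [h] at h'
  | leftMerge h' => simp [h] at h'

theorem HasLeftSum.leftPass {s p a b A B : ℕ} {x : S} (h : D[s]? = some (.left p))
    (hx : HasLeftSum D φ s a b x) (hab : a < b) (hA : A = strandShift p a)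
    (hB : B = strandShift p b) : HasLeftSum D φ (s + 1) A B x := by
  refine hx.of_bijective (fun u => .leftPassLeft h hab hA hB u)
    ⟨fun u v huv => by simpa using huv, fun u => ?_⟩ (fun _ => by simp [DiskPart.word])
  have ha' := strandShift_ne p a
  have hb' := strandShift_ne p b
  cases u with
  | leftEnd h' ha hb =>
    obtain rfl : p = _ := by simpa using h.symm.trans h'
    omega
  | leftPassLeft h' hab ha hb u =>
    obtain rfl : p = _ := by simpa using h.symm.trans h'
    obtain rfl := (strandShift_strictMono p).injective (hA.symm.trans ha)
    obtain rfl := (strandShift_strictMono p).injective (hB.symm.trans hb)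
    exact ⟨u, rfl⟩
  | leftSplitUpper h' hap hpb ha hb u v =>
    obtain rfl : p = _ := by simpa using h.symm.trans h'
    omega
  | leftSplitLower h' hap hpb ha hb u v =>
    obtain rfl : p = _ := by simpa using h.symm.trans h'
    omega
  | leftPassCross h' => simp [h] at h'
  | leftPassRight h' => simp [h] at h'
  | leftMerge h' => simp [h] at h'

/-- At a left extremum, an interval with exactly one end on the new strands is a branch of a
splitting, whose other branch goes to the right. -/
theorem hasLeftSum_leftSplit {s p a b : ℕ} (h : D[s]? = some (.left p))
    (hr : ∀ a b, IsEmpty (DiskPart D .rightward (s + 1) a b))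
    (hne : ¬ (a = p ∧ b = p + 1)) (hmem : a = p ∨ a = p + 1 ∨ b = p ∨ b = p + 1) :
    HasLeftSum D φ (s + 1) a b 0 := by
  refine .of_isEmpty ⟨fun u => ?_⟩
  cases u with
  | leftEnd h' ha hb =>
    obtain rfl : p = _ := by simpa using h.symm.trans h'
    exact hne ⟨ha, hb⟩
  | leftPassLeft h' hab ha hb u =>
    obtain rfl : p = _ := by simpa using h.symm.trans h'
    have ha' := strandShift_ne p
    rw [ha, hb] at hmem
    rcases hmem with h | h | h | h
    exacts [(ha' _).1 h, (ha' _).2 h, (ha' _).1 h, (ha' _).2 h]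
  | leftSplitUpper h' hap hpb ha hb u v => exact (hr _ _).false v
  | leftSplitLower h' hap hpb ha hb u v => exact (hr _ _).false v
  | leftPassCross h' => simp [h] at h'
  | leftPassRight h' => simp [h] at h'
  | leftMerge h' => simp [h] at h'

/-- A part of a disk beyond a crossing arises from a part on the other side of the crossing. -/
theorem DiskPart.exists_of_leftCross {s p a' b' : ℕ} {c : R} (h : D[s]? = some (.cross p c))
    (u : DiskPart D .leftward (s + 1) a' b') :
    ∃ (a b : ℕ) (x y : CEWord R T) (hab : a < b) (hab' : a' < b') (ha : UpperStep T p c a a' x)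
      (hb : LowerStep T p c b b' y) (v : DiskPart D .leftward s a b),
      u = .leftPassCross h hab hab' ha hb v := by
  cases u with
  | leftPassCross h' hab hab' ha hb v =>
    obtain ⟨rfl, rfl⟩ : p = _ ∧ c = _ := by simpa using h.symm.trans h'
    exact ⟨_, _, _, _, hab, hab', ha, hb, v, rfl⟩
  | leftEnd h' => simp [h] at h'
  | leftPassLeft h' => simp [h] at h'
  | leftSplitUpper h' => simp [h] at h'
  | leftSplitLower h' => simp [h] at h'
  | leftPassRight h' => simp [h] at h'
  | leftMerge h' => simp [h] at h'

theorem HasLeftSum.crossAway {s p a b : ℕ} {c : R} {x : S} (h : D[s]? = some (.cross p c))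
    (hx : HasLeftSum D φ s a b x) (hab : a < b) (ha : a ≠ p ∧ a ≠ p + 1)
    (hb : b ≠ p ∧ b ≠ p + 1) : HasLeftSum D φ (s + 1) a b x := by
  refine hx.of_bijective
    (fun u => .leftPassCross h hab hab (.away a ha.1 ha.2) (.away b hb.1 hb.2) u)
    ⟨fun u v huv => by simpa using huv, fun u => ?_⟩ (fun _ => by simp [DiskPart.word])
  obtain ⟨a', b', x, y, hab, hab', ha', hb', v, rfl⟩ := u.exists_of_leftCross h
  cases ha' <;> cases hb' <;> first | exact ⟨v, rfl⟩ | omega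

theorem HasLeftSum.crossLowerDescend {s p q a : ℕ} {c : R} {x : S}
    (h : D[s]? = some (.cross p c)) (hx : HasLeftSum D φ s a p x) (ha : a < p) (hq : q = p + 1) :
    HasLeftSum D φ (s + 1) a q x := by
  have hstep : LowerStep T p c p q 1 := hq ▸ .descend
  refine hx.of_bijective
    (fun u => .leftPassCross h ha (by omega) (.away a (by omega) (by omega)) hstep u)
    ⟨fun u v huv => by simpa using huv, fun u => ?_⟩ (fun _ => by simp [DiskPart.word])
  obtain ⟨a', b', x, y, hab, hab', ha', hb', v, rfl⟩ := u.exists_of_leftCross h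
  cases ha' <;> cases hb' <;> first | exact ⟨v, rfl⟩ | omega

theorem HasLeftSum.crossLower {s p a : ℕ} {c : R} {x y : S} (h : D[s]? = some (.cross p c))
    (hx : HasLeftSum D φ s a p x) (hy : HasLeftSum D φ s a (p + 1) y) (ha : a < p) :
    HasLeftSum D φ (s + 1) a p (x * φ (chordWord T c) + y) := by
  refine ((HasTotal.mul_right hx (φ (chordWord T c))).sum hy).of_bijective
    (Sum.elim
      (fun u => .leftPassCross h ha ha (.away a (by omega) (by omega)) .corner u)
      (fun u => .leftPassCross h (by omega) ha (.away a (by omega) (by omega)) .ascend u))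
    ⟨?_, fun u => ?_⟩ ?_
  · rintro (u | u) (v | v) huv <;> simp at huv ⊢ <;> exact huv
  · obtain ⟨a', b', x, y, hab, hab', ha', hb', v, rfl⟩ := u.exists_of_leftCross h
    cases ha' with
    | away _ _ _ =>
      cases hb' with
      | away _ _ _ => omega
      | ascend => exact ⟨.inr v, rfl⟩
      | corner => exact ⟨.inl v, rfl⟩
    | descend => omega
    | ascend => omega
    | corner => omega
  · rintro (u | u) <;> simp [DiskPart.word]

theorem HasLeftSum.crossUpper {s p q b : ℕ} {c : R} {x : S} (h : D[s]? = some (.cross p c))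
    (hx : HasLeftSum D φ s p b x) (hy : IsEmpty (DiskPart D .leftward s q b))
    (hb : q < b) (hq : q = p + 1) : HasLeftSum D φ (s + 1) q b x := by
  have hstep : UpperStep T p c p q 1 := hq ▸ .descend
  refine hx.of_bijective
    (fun u => .leftPassCross h (by omega) hb hstep (.away b (by omega) (by omega)) u)
    ⟨fun u v huv => by simpa using huv, fun u => ?_⟩ (fun _ => by simp [DiskPart.word])
  obtain ⟨a', b', x, y, hab, hab', ha', hb', v, rfl⟩ := u.exists_of_leftCross h
  cases hb' with
  | away _ _ _ =>
    cases ha' with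
    | away _ _ _ => omega
    | descend => exact ⟨v, rfl⟩
    | ascend => omega
    | corner => exact (hy.false v).elim
  | descend => omega
  | ascend => omega
  | corner => omega

theorem HasLeftSum.right {s p a b : ℕ} {t : T} {x y z : S} (h : D[s]? = some (.right p t))
    (hx : HasLeftSum D φ s a (b + 2) x) (hy : HasLeftSum D φ s a p y)
    (hz : HasLeftSum D φ s (p + 1) (b + 2) z) (ha : a < p) (hb : p ≤ b) :
    HasLeftSum D φ (s + 1) a b (x + y * φ (markWord R (FreeGroup.of t)) * z) := by
  rw [← strandShift_of_le hb] at hx hz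
  rw [← strandShift_of_lt ha] at hx hy
  refine (hx.sum ((HasTotal.mul_right hy (φ (markWord R (FreeGroup.of t)))).prod hz)).of_bijective
    (Sum.elim (fun u => .leftPassRight h (by omega) u) (fun q => .leftMerge h ha hb q.1 q.2))
    ⟨?_, fun u => ?_⟩ ?_
  · rintro (u | u) (v | v) huv <;> simp [Prod.ext_iff] at huv ⊢ <;> exact huv
  · cases u with
    | leftPassRight h' hab u =>
      obtain ⟨rfl, rfl⟩ : p = _ ∧ t = _ := by simpa using h.symm.trans h'
      exact ⟨.inl u, rfl⟩
    | leftMerge h' hap hpb u v =>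
      obtain ⟨rfl, rfl⟩ : p = _ ∧ t = _ := by simpa using h.symm.trans h'
      exact ⟨.inr (u, v), rfl⟩
    | leftEnd h' => simp [h] at h'
    | leftPassLeft h' => simp [h] at h'
    | leftSplitUpper h' => simp [h] at h'
    | leftSplitLower h' => simp [h] at h'
    | leftPassCross h' => simp [h] at h'
  · rintro (u | u) <;> simp [DiskPart.word]

/-- A disk whose positive corner is at a crossing directly followed by a right extremum on the same
strands lies on the left of the crossing, or it is the lobe between the crossing and the
extremum. -/
theorem HasLeftSum.immersedDisk {s p : ℕ} {c : R} {t : T} {x : S}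
    (hx : HasLeftSum D φ s p (p + 1) x) (h : D[s]? = some (.cross p c))
    (ht : D[s + 1]? = some (.right p t))
    (huniq : ∀ s' p', D[s']? = some (.cross p' c) → s' = s) :
    HasTotal (fun u : ImmersedDisk D c => φ u.word)
      (x + φ (markWord R (FreeGroup.of t)⁻¹)) := by
  refine (hx.sum (HasTotal.punit fun _ => φ (markWord R (FreeGroup.of t)⁻¹))).of_bijective
    (Sum.elim (fun u => .atLeftQuadrant s p h u)
      (fun _ => .atRightQuadrant s p h (.rightEnd ht rfl rfl)))
    ⟨?_, fun u => ?_⟩ ?_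
  · rintro (u | u) (v | v) huv <;> first | rfl | simp at huv
    exact congrArg _ huv
  · cases u with
    | atLeftQuadrant s' p' h' u =>
      obtain rfl := huniq s' p' h'
      obtain rfl : p = _ := by simpa using h.symm.trans h'
      exact ⟨.inl u, rfl⟩
    | atRightQuadrant s' p' h' u =>
      obtain rfl := huniq s' p' h'
      obtain rfl : p = _ := by simpa using h.symm.trans h'
      refine ⟨.inr (), ?_⟩
      simp only [Sum.elim_inr]
      congr 1
      cases u with
      | rightEnd h' ha hb =>
        obtain ⟨-, rfl⟩ : p = _ ∧ t = _ := by simpa using ht.symm.trans h'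
        subst ha
        rfl
      | rightPassRight h' hab ha hb u =>
        obtain ⟨rfl, -⟩ : p = _ ∧ t = _ := by simpa using ht.symm.trans h'
        exact absurd ha.symm (strandShift_ne _ _).1
      | rightMergeUpper h' hap hpb ha hb u v =>
        obtain ⟨rfl, -⟩ : p = _ ∧ t = _ := by simpa using ht.symm.trans h'
        exact absurd ha.symm (strandShift_ne _ _).1
      | rightMergeLower h' hap hpb ha hb u v =>
        obtain ⟨rfl, -⟩ : p = _ ∧ t = _ := by simpa using ht.symm.trans h'
        omega
      | rightPassCross h' => simp [ht] at h'
      | rightPassLeft h' => simp [ht] at h'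
      | rightSplit h' => simp [ht] at h'
  · rintro (u | u) <;> simp [DiskPart.word, ImmersedDisk.word]

end Recursion

/-! ### The diagram of the rainbow closure -/

theorem getElem?_flatten_ofFn_pair {α : Type*} {n : ℕ} (f g : Fin n → α) (k : Fin n) :
    (List.ofFn fun k => [f k, g k]).flatten[2 * (k : ℕ)]? = some (f k) ∧
      (List.ofFn fun k => [f k, g k]).flatten[2 * (k : ℕ) + 1]? = some (g k) := by
  induction n with
  | zero => exact k.elim0
  | succ n ih =>
    rw [List.ofFn_succ]
    induction k using Fin.cases with
    | zero => simp
    | succ k =>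
      have := ih (fun k => f k.succ) (fun k => g k.succ) k
      simpa [mul_add, add_right_comm] using this

theorem length_flatten_ofFn_pair {α : Type*} {n : ℕ} (f g : Fin n → α) :
    (List.ofFn fun k => [f k, g k]).flatten.length = 2 * n := by
  simp [List.length_flatten, List.map_ofFn, Function.comp_def, mul_comm]

section Diagram

variable {n l : ℕ} (i : Fin l → Fin (n - 1))

theorem rainbowClosure_left (s : ℕ) (hs : s < n) :
    (rainbowClosure i)[s]? = some (.left s) := by
  simp [rainbowClosure, hs, Nat.lt_add_right]

theorem rainbowClosure_braid (k : Fin l) :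
    (rainbowClosure i)[n + k]? = some (.cross (n + i k) (.inl k)) := by
  simp [rainbowClosure, List.getElem?_append]

theorem rainbowClosure_cusp_cross (k : Fin n) :
    (rainbowClosure i)[n + l + 2 * k]? = some (.cross (n - 1 - k) (.inr k)) := by
  have := (getElem?_flatten_ofFn_pair
    (fun k : Fin n => DiagramPiece.cross (T := Fin n) (n - 1 - (k : ℕ)) (Sum.inr (α := Fin l) k))
    (fun k : Fin n => DiagramPiece.right (n - 1 - (k : ℕ)) k) k).1
  rw [rainbowClosure, List.getElem?_append_right (by simp)]
  simpa using this

theorem rainbowClosure_cusp_right (k : Fin n) :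
    (rainbowClosure i)[n + l + 2 * k + 1]? = some (.right (n - 1 - k) k) := by
  have := (getElem?_flatten_ofFn_pair
    (fun k : Fin n => DiagramPiece.cross (T := Fin n) (n - 1 - (k : ℕ)) (Sum.inr (α := Fin l) k))
    (fun k : Fin n => DiagramPiece.right (n - 1 - (k : ℕ)) k) k).2
  rw [rainbowClosure, List.getElem?_append_right (by simp; omega)]
  convert this using 2
  simp
  omega

theorem length_rainbowClosure : (rainbowClosure i).length = n + l + 2 * n := by
  rw [rainbowClosure, List.length_append, List.length_append, length_flatten_ofFn_pair]
  simp

/-- The position of a piece of the rainbow closure determines its kind. -/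
theorem rainbowClosure_cases {s : ℕ} {x : DiagramPiece (Fin l ⊕ Fin n) (Fin n)}
    (h : (rainbowClosure i)[s]? = some x) :
    (s < n ∧ x = .left s) ∨
    (∃ k : Fin l, s = n + k ∧ x = .cross (n + i k) (.inl k)) ∨
    (∃ k : Fin n, s = n + l + 2 * k ∧ x = .cross (n - 1 - k) (.inr k)) ∨
    (∃ k : Fin n, s = n + l + 2 * k + 1 ∧ x = .right (n - 1 - k) k) := by
  have hs : s < n + l + 2 * n := by
    rw [← length_rainbowClosure i]
    exact (List.getElem?_eq_some_iff.1 h).1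
  by_cases h1 : s < n
  · exact .inl ⟨h1, by simpa [rainbowClosure_left i s h1] using h.symm⟩
  by_cases h2 : s < n + l
  · obtain ⟨k, rfl⟩ := Nat.exists_eq_add_of_le (not_lt.1 h1)
    refine .inr (.inl ⟨⟨k, by omega⟩, rfl, ?_⟩)
    simpa [rainbowClosure_braid i ⟨k, by omega⟩] using
      (h.symm.trans (rainbowClosure_braid i ⟨k, by omega⟩))
  obtain ⟨m, rfl⟩ := Nat.exists_eq_add_of_le (not_lt.1 h2)
  obtain ⟨k, rfl | rfl⟩ : ∃ k, m = 2 * k ∨ m = 2 * k + 1 := ⟨m / 2, by omega⟩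
  · refine .inr (.inr (.inl ⟨⟨k, by omega⟩, rfl, ?_⟩))
    simpa using h.symm.trans (rainbowClosure_cusp_cross i ⟨k, by omega⟩)
  · refine .inr (.inr (.inr ⟨⟨k, by omega⟩, rfl, ?_⟩))
    simpa using h.symm.trans (rainbowClosure_cusp_right i ⟨k, by omega⟩)

/-- The strands of slab `s` of the rainbow closure on which the binary Maslov potential is `1`: the
upper strands, except that the two innermost strands have just been exchanged in a slab between the
crossing and the extremum of a right cusp. -/
def IsUpperStrand (n l s x : ℕ) : Prop :=
  if s ≤ n then x < s
  else if s ≤ n + l then x < n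
  else if (s - n - l) % 2 = 0 then x + (s - n - l) / 2 < n
  else x + (s - n - l) / 2 + 1 < n ∨ x + (s - n - l) / 2 = n

open Classical in
/-- The binary Maslov potential of the rainbow closure. -/
noncomputable def rainbowPotential (n l s x : ℕ) : ℤ :=
  if IsUpperStrand n l s x then 1 else 0

theorem rainbowPotential_lt_iff {s a b : ℕ} :
    rainbowPotential n l s b < rainbowPotential n l s a ↔
      IsUpperStrand n l s a ∧ ¬ IsUpperStrand n l s b := by
  unfold rainbowPotential
  split_ifs <;> simp_all

theorem isUpperStrand_of_le {s x : ℕ} (hs : s ≤ n) : IsUpperStrand n l s x ↔ x < s := by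
  simp [IsUpperStrand, hs]

theorem isUpperStrand_braid {k x : ℕ} (hk : k ≤ l) : IsUpperStrand n l (n + k) x ↔ x < n := by
  unfold IsUpperStrand
  split_ifs <;> omega

theorem isUpperStrand_cusp {k x : ℕ} (hk : k ≤ n) :
    IsUpperStrand n l (n + l + 2 * k) x ↔ x < n - k := by
  unfold IsUpperStrand
  split_ifs <;> omega

theorem isUpperStrand_cusp_extremum {k x : ℕ} (hk : k < n) :
    IsUpperStrand n l (n + l + 2 * k + 1) x ↔ x < n - 1 - k ∨ x = n - k := by
  unfold IsUpperStrand
  split_ifs <;> omega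

theorem rainbowPotential_congr {s s' x x' : ℕ}
    (h : IsUpperStrand n l s x ↔ IsUpperStrand n l s' x') :
    rainbowPotential n l s x = rainbowPotential n l s' x' := by
  by_cases h' : IsUpperStrand n l s' x'
  · rw [rainbowPotential, rainbowPotential, if_pos h', if_pos (h.2 h')]
  · rw [rainbowPotential, rainbowPotential, if_neg h', if_neg (mt h.1 h')]

theorem rainbowPotential_of_upper {s x : ℕ} (h : IsUpperStrand n l s x) :
    rainbowPotential n l s x = 1 := by
  simp [rainbowPotential, h]

theorem rainbowPotential_of_lower {s x : ℕ} (h : ¬ IsUpperStrand n l s x) :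
    rainbowPotential n l s x = 0 := by
  simp [rainbowPotential, h]

theorem isUpperStrand_strandShift {p m x : ℕ} (hp : p ≤ m) (hm : m ≤ p + 2) :
    strandShift p x < m ↔ x < p := by
  unfold strandShift
  split_ifs <;> omega

theorem isMaslovPotential_rainbow :
    IsMaslovPotential (rainbowClosure i) rainbowDegree (rainbowPotential n l) where
  left_new {s p} h := by
    obtain ⟨hs, e⟩ | ⟨k, rfl, e⟩ | ⟨k, rfl, e⟩ | ⟨k, rfl, e⟩ := rainbowClosure_cases i h <;>
      cases e
    rw [rainbowPotential_of_upper, rainbowPotential_of_lower, zero_add] <;>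
    rw [isUpperStrand_of_le hs] <;> omega
  left_old {s p} h x := by
    obtain ⟨hs, e⟩ | ⟨k, rfl, e⟩ | ⟨k, rfl, e⟩ | ⟨k, rfl, e⟩ := rainbowClosure_cases i h <;>
      cases e
    apply rainbowPotential_congr
    rw [isUpperStrand_of_le hs, isUpperStrand_of_le hs.le,
      isUpperStrand_strandShift (by omega) (by omega)]
  right_new {s p t} h := by
    obtain ⟨hs, e⟩ | ⟨k, rfl, e⟩ | ⟨k, rfl, e⟩ | ⟨k, rfl, e⟩ := rainbowClosure_cases i h <;>
      cases e
    rw [rainbowPotential_of_upper, rainbowPotential_of_lower, zero_add] <;>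
    rw [isUpperStrand_cusp_extremum t.isLt] <;> omega
  right_old {s p t} h x := by
    obtain ⟨hs, e⟩ | ⟨k, rfl, e⟩ | ⟨k, rfl, e⟩ | ⟨k, rfl, e⟩ := rainbowClosure_cases i h <;>
      cases e
    apply rainbowPotential_congr
    rw [isUpperStrand_cusp_extremum t.isLt,
      show n + l + 2 * (t : ℕ) + 1 + 1 = n + l + 2 * (t + 1) by ring,
      isUpperStrand_cusp (by omega), strandShift]
    split_ifs <;> omega
  cross_deg {s p c} h := by
    obtain ⟨hs, e⟩ | ⟨k, rfl, e⟩ | ⟨k, rfl, e⟩ | ⟨k, rfl, e⟩ := rainbowClosure_cases i h <;>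
      cases e
    · rw [rainbowPotential_of_lower, rainbowPotential_of_lower]
      · rfl
      all_goals rw [isUpperStrand_braid k.isLt.le]; omega
    · rw [rainbowPotential_of_upper, rainbowPotential_of_lower]
      · rfl
      all_goals rw [isUpperStrand_cusp k.isLt.le]; omega
  cross_descend {s p c} h := by
    obtain ⟨hs, e⟩ | ⟨k, rfl, e⟩ | ⟨k, rfl, e⟩ | ⟨k, rfl, e⟩ := rainbowClosure_cases i h <;>
      cases e
    all_goals apply rainbowPotential_congr
    · rw [isUpperStrand_braid k.isLt.le, add_assoc n, isUpperStrand_braid k.isLt]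
      omega
    · rw [isUpperStrand_cusp k.isLt.le, isUpperStrand_cusp_extremum k.isLt]
      omega
  cross_ascend {s p c} h := by
    obtain ⟨hs, e⟩ | ⟨k, rfl, e⟩ | ⟨k, rfl, e⟩ | ⟨k, rfl, e⟩ := rainbowClosure_cases i h <;>
      cases e
    all_goals apply rainbowPotential_congr
    · rw [isUpperStrand_braid k.isLt.le, add_assoc n, isUpperStrand_braid k.isLt]
      omega
    · rw [isUpperStrand_cusp k.isLt.le, isUpperStrand_cusp_extremum k.isLt]
      omega
  cross_away {s p c} h x hx hx' := by
    obtain ⟨hs, e⟩ | ⟨k, rfl, e⟩ | ⟨k, rfl, e⟩ | ⟨k, rfl, e⟩ := rainbowClosure_cases i h <;>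
      cases e
    all_goals apply rainbowPotential_congr
    · rw [isUpperStrand_braid k.isLt.le, add_assoc n, isUpperStrand_braid k.isLt]
    · rw [isUpperStrand_cusp k.isLt.le, isUpperStrand_cusp_extremum k.isLt]
      omega

theorem rainbowDegree_nonneg (c : Fin l ⊕ Fin n) : 0 ≤ rainbowDegree c := by
  cases c <;> simp [rainbowDegree]

/-- A part of a disk on the left of an interval has its upper end on an upper strand and its lower
end on a lower strand. -/
theorem DiskPart.isUpperStrand_of_leftward {s a b : ℕ}
    (u : DiskPart (rainbowClosure i) .leftward s a b) :
    IsUpperStrand n l s a ∧ ¬ IsUpperStrand n l s b :=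
  rainbowPotential_lt_iff.1
    ((isMaslovPotential_rainbow i).lt_of_leftward rainbowDegree_nonneg u)

theorem DiskPart.isUpperStrand_of_rightward {s a b : ℕ}
    (u : DiskPart (rainbowClosure i) .rightward s a b) :
    IsUpperStrand n l s b ∧ ¬ IsUpperStrand n l s a :=
  rainbowPotential_lt_iff.1
    ((isMaslovPotential_rainbow i).lt_of_rightward rainbowDegree_nonneg u)

/-- In front of the right cusps all upper strands lie above all lower strands, so no part of a disk
without positive corner can lie on the right of an interval. -/
theorem isEmpty_rightward {s : ℕ} (hs : s ≤ n + l) (a b : ℕ) :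
    IsEmpty (DiskPart (rainbowClosure i) .rightward s a b) := by
  refine ⟨fun u => ?_⟩
  have hab := u.lt
  have h := u.isUpperStrand_of_rightward
  by_cases h1 : s ≤ n
  · rw [isUpperStrand_of_le h1, isUpperStrand_of_le h1] at h
    omega
  · obtain ⟨k, rfl⟩ := Nat.exists_eq_add_of_le (not_le.1 h1).le
    rw [isUpperStrand_braid (by omega), isUpperStrand_braid (by omega)] at h
    omega

/-- No disk has its only positive corner at a crossing of the braid. -/
theorem isEmpty_immersedDisk_braid (k : Fin l) :
    IsEmpty (ImmersedDisk (rainbowClosure i) (.inl k)) := by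
  refine ⟨fun u => ?_⟩
  cases u with
  | atLeftQuadrant s p h u =>
    have h' := u.isUpperStrand_of_leftward
    obtain ⟨hs, e⟩ | ⟨k, rfl, e⟩ | ⟨k, rfl, e⟩ | ⟨k, rfl, e⟩ := rainbowClosure_cases i h <;>
      cases e
    rw [isUpperStrand_braid k.isLt.le, isUpperStrand_braid k.isLt.le] at h'
    omega
  | atRightQuadrant s p h u =>
    obtain ⟨hs, e⟩ | ⟨k, rfl, e⟩ | ⟨k, rfl, e⟩ | ⟨k, rfl, e⟩ := rainbowClosure_cases i h <;>
      cases e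
    exact (isEmpty_rightward i (by omega) _ _).false u

end Diagram

/-! ### Disk sums of the rainbow closure -/

section Sums

variable {n l : ℕ} (i : Fin l → Fin (n - 1)) {S : Type*} [CommRing S]

/-- The entries of a matrix, indexed by natural numbers and extended by zero. -/
def natEntry (M : Matrix (Fin n) (Fin n) S) (r j : ℕ) : S :=
  if h : r < n ∧ j < n then M ⟨r, h.1⟩ ⟨j, h.2⟩ else 0

theorem natEntry_one {r j : ℕ} (hr : r < n) :
    natEntry (1 : Matrix (Fin n) (Fin n) S) r j = if r = j then 1 else 0 := by
  unfold natEntry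
  split_ifs with h1 h2 h2
  · subst h2
    exact Matrix.one_apply_eq _
  · exact Matrix.one_apply_ne (by simpa using h2)
  · omega
  · rfl

theorem natEntry_mul_braidZ (M : Matrix (Fin n) (Fin n) S) (q : Fin (n - 1)) (b : S) (r j : ℕ) :
    natEntry (M * braidZ q b) r j =
      if j = q then natEntry M r q * b + natEntry M r (q + 1)
      else if j = q + 1 then natEntry M r q
      else natEntry M r j := by
  have hq := q.isLt
  have hM (x : ℕ) (hx : x < n) (y : Fin n) : natEntry M x y = M ⟨x, hx⟩ y := by
    simp [natEntry, hx]
  by_cases hr : r < n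
  swap
  · simp [natEntry, hr]
  by_cases hj : j < n
  swap
  · rw [if_neg (by omega), if_neg (by omega)]
    simp [natEntry, hj]
  set q0 : Fin n := ⟨q, by omega⟩ with hq0
  set q1 : Fin n := ⟨q + 1, by omega⟩ with hq1
  have hne : q0 ≠ q1 := by simp [hq0, hq1]
  have e0 : natEntry M r q = M ⟨r, hr⟩ q0 := hM r hr q0
  have e1 : natEntry M r (q + 1) = M ⟨r, hr⟩ q1 := hM r hr q1
  have ej : natEntry M r j = M ⟨r, hr⟩ ⟨j, hj⟩ := hM r hr ⟨j, hj⟩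
  rw [e0, e1, ej]
  rw [show natEntry (M * braidZ q b) r j = (M * braidZ q b) ⟨r, hr⟩ ⟨j, hj⟩ by
    simp [natEntry, hr, hj], Matrix.mul_apply]
  split_ifs with h1 h2
  · rw [← Finset.sum_subset (Finset.subset_univ {q0, q1}), Finset.sum_pair hne]
    · simp [braidZ, hq0, hq1, h1]
    · intro x _ hx
      simp only [Finset.mem_insert, Finset.mem_singleton, not_or, Fin.ext_iff, hq0, hq1] at hx
      simp only [braidZ, Matrix.of_apply, hx.1, hx.2, false_and, if_false, Fin.ext_iff, h1,
        mul_zero]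
  · rw [Finset.sum_eq_single q0]
    · simp [braidZ, hq0, h2]
    · intro x _ hx
      simp only [ne_eq, Fin.ext_iff, hq0] at hx
      simp +contextual [braidZ, Fin.ext_iff, h2, hx]
    · simp
  · rw [Finset.sum_eq_single ⟨j, hj⟩]
    · simp [braidZ, h1, h2]
    · intro x _ hx
      simp only [ne_eq, Fin.ext_iff] at hx
      simp [braidZ, Fin.ext_iff, h1, h2, hx]
    · simp

/-- The product of the matrices of the first `k` letters of a braid word. -/
def braidPrefix (b : Fin l → S) (k : ℕ) : Matrix (Fin n) (Fin n) S :=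
  ((List.ofFn fun k : Fin l => braidZ (i k) (b k)).take k).prod

theorem braidPrefix_zero (b : Fin l → S) : braidPrefix i b 0 = 1 := rfl

theorem braidPrefix_succ (b : Fin l → S) (k : Fin l) :
    braidPrefix i b (k + 1) = braidPrefix i b k * braidZ (i k) (b k) := by
  rw [braidPrefix, List.take_add_one]
  simp [braidPrefix]

theorem braidPrefix_length (b : Fin l → S) : braidPrefix i b l = braidMatrix i b := by
  rw [braidPrefix, List.take_of_length_le (by simp), braidMatrix]

/-- The iterated rank-one update `A ↦ A + A_{• k} τ_k A_{k •}`, for `k = 0, 1, 2, …`. -/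
def cuspIterate (A : ℕ → ℕ → S) (τ : ℕ → S) : ℕ → ℕ → ℕ → S
  | 0, r, j => A r j
  | k + 1, r, j => cuspIterate A τ k r j + cuspIterate A τ k r k * τ k * cuspIterate A τ k k j

variable (φ : CEWord (Fin l ⊕ Fin n) (Fin n) →* S)

/-- Between the left cusps, the disks on the left of an interval are the strips between the two
strands of a left cusp. -/
theorem hasLeftSum_leftCusps {s : ℕ} (hs : s ≤ n) {a b : ℕ} (hab : a < b) :
    HasLeftSum (rainbowClosure i) φ s a b (if a + b + 1 = 2 * s then 1 else 0) := by
  induction s generalizing a b with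
  | zero =>
    rw [if_neg (by omega)]
    exact hasLeftSum_zero a b
  | succ s ih =>
    have h := rainbowClosure_left i s hs
    by_cases hu : a < s + 1 ∧ s + 1 ≤ b
    swap
    · rw [if_neg (by omega)]
      refine .of_isEmpty ⟨fun u => hu ?_⟩
      have hu := u.isUpperStrand_of_leftward
      rw [isUpperStrand_of_le hs, isUpperStrand_of_le hs] at hu
      omega
    by_cases h1 : a = s ∧ b = s + 1
    · obtain ⟨rfl, rfl⟩ := h1
      rw [if_pos (by omega)]
      exact hasLeftSum_leftEnd h
    by_cases h2 : a = s ∨ b = s + 1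
    · rw [if_neg (by omega)]
      exact hasLeftSum_leftSplit h (isEmpty_rightward i (by omega)) h1 (by omega)
    · obtain ⟨b, rfl⟩ : ∃ b', b = b' + 2 := ⟨b - 2, by omega⟩
      have := (ih (by omega) (a := a) (b := b) (by omega)).leftPass h (by omega)
        (strandShift_of_lt (by omega)).symm (strandShift_of_le (by omega)).symm
      convert this using 1
      congr 1
      simp only [eq_iff_iff]
      omega

/-- In the braid, the disks on the left of an interval are counted by the product of the matrices of
the crossings passed so far. -/
theorem hasLeftSum_braid {b : Fin l → S} (hb : ∀ k, φ (chordWord _ (.inl k)) = b k) {k : ℕ}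
    (hk : k ≤ l) {a j : ℕ} (ha : a < n) :
    HasLeftSum (rainbowClosure i) φ (n + k) a (n + j)
      (natEntry (braidPrefix i b k) (n - 1 - a) j) := by
  induction k generalizing j with
  | zero =>
    have := hasLeftSum_leftCusps i φ le_rfl (a := a) (b := n + j) (by omega)
    rw [braidPrefix_zero, natEntry_one (by omega)]
    convert this using 2
    simp
    omega
  | succ k ih =>
    have h := rainbowClosure_braid i ⟨k, hk⟩
    replace ih (j : ℕ) := @ih (by omega) j
    rw [braidPrefix_succ i b ⟨k, hk⟩, natEntry_mul_braidZ, ← add_assoc]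
    split_ifs with h1 h2
    · subst h1
      rw [← hb]
      exact (ih _).crossLower h (ih ((i ⟨k, hk⟩ : ℕ) + 1)) (by omega)
    · subst h2
      exact (ih _).crossLowerDescend h (by omega) (by simp [add_assoc])
    · exact (ih _).crossAway h (by omega) (by simp; omega) (by simp; omega)

/-- Each right cusp changes the disk sums by the update of `cuspIterate`: a disk either passes below
the cusp or wraps around its extremum. -/
theorem hasLeftSum_cusps {b : Fin l → S} (hb : ∀ k, φ (chordWord _ (.inl k)) = b k) {τ : ℕ → S}
    (hτ : ∀ j : Fin n, φ (markWord _ (FreeGroup.of j)) = τ j) {k : ℕ} (hk : k ≤ n) {a j : ℕ}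
    (ha : a < n - k) (hj : k ≤ j) :
    HasLeftSum (rainbowClosure i) φ (n + l + 2 * k) a (n - k + (j - k))
      (cuspIterate (natEntry (braidMatrix i b)) τ k (n - 1 - a) j) := by
  induction k generalizing a j with
  | zero =>
    rw [← braidPrefix_length]
    exact hasLeftSum_braid i φ hb le_rfl (by omega)
  | succ k ih =>
    have ih := @ih (by omega)
    have hc := rainbowClosure_cusp_cross i ⟨k, hk⟩
    have hr := rainbowClosure_cusp_right i ⟨k, hk⟩
    simp only at hc hr
    obtain ⟨j, rfl⟩ : ∃ j', j = k + 1 + j' := ⟨j - (k + 1), by omega⟩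
    obtain ⟨m, rfl⟩ : ∃ m, n = k + 1 + m := ⟨n - (k + 1), by omega⟩
    simp only [show k + 1 + m - 1 - k = m by omega] at hc hr
    have e1 : k + 1 + m - (k + 1) = m := by omega
    have e2 : k + 1 + j - (k + 1) = j := by omega
    rw [e1] at ha
    rw [e1, e2]
    have ih1 := ih (a := a) (j := k + 1 + j) (by omega) (by omega)
    have ih2 := ih (a := a) (j := k) (by omega) (by omega)
    have ih3 := ih (a := m) (j := k + 1 + j) (by omega) (by omega)
    rw [show k + 1 + m - k + (k + 1 + j - k) = m + j + 2 by omega] at ih1 ih3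
    rw [show k + 1 + m - k + (k - k) = m + 1 by omega] at ih2
    rw [show k + 1 + m - 1 - m = k by omega] at ih3
    have hempty (x : ℕ) {y : ℕ} (hy : (y < m + 1 ∨ m + 1 ≤ x)) :
        IsEmpty (DiskPart (rainbowClosure i) .leftward (k + 1 + m + l + 2 * k) x y) := by
      refine ⟨fun u => ?_⟩
      have hu := u.isUpperStrand_of_leftward
      rw [isUpperStrand_cusp (by omega), isUpperStrand_cusp (by omega)] at hu
      omega
    -- corners at the crossing of the cusp do not occur, because the parts beyond them would join two
    -- upper or two lower strands
    have hx := ih1.crossAway hc (by omega) (by omega) (by omega)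
    have hy := (HasLeftSum.of_isEmpty (hempty a (y := m) (by omega))).crossLower hc ih2 ha
    have hz := ih3.crossUpper hc (hempty _ (by omega)) (by omega) rfl
    rw [zero_mul, zero_add] at hy
    have := hx.right hr hy hz ha (by omega)
    rw [hτ] at this
    exact this

/-- The disks with positive corner at the `k`-th right cusp. -/
theorem hasTotal_immersedDisk_cusp {b : Fin l → S} (hb : ∀ k, φ (chordWord _ (.inl k)) = b k)
    {τ : ℕ → S} (hτ : ∀ j : Fin n, φ (markWord _ (FreeGroup.of j)) = τ j) (k : Fin n) :
    HasTotal (fun u : ImmersedDisk (rainbowClosure i) (.inr k) => φ u.word)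
      (cuspIterate (natEntry (braidMatrix i b)) τ k k k +
        φ (markWord _ (FreeGroup.of k)⁻¹)) := by
  have h := hasLeftSum_cusps i φ hb hτ k.isLt.le (a := n - 1 - k) (j := k) (by omega) le_rfl
  rw [show n - (k : ℕ) + (k - k) = n - 1 - k + 1 by omega,
    show n - 1 - (n - 1 - (k : ℕ)) = k by omega] at h
  refine h.immersedDisk (rainbowClosure_cusp_cross i k) (rainbowClosure_cusp_right i k) ?_
  intro s p h
  obtain ⟨hs, e⟩ | ⟨k, rfl, e⟩ | ⟨k, rfl, e⟩ | ⟨k, rfl, e⟩ := rainbowClosure_cases i h <;>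
      cases e
  rfl

end Sums

/-! ### Gaussian elimination and principal minors -/

section Minors

variable {S : Type*} [CommRing S]

/-- One step of Gaussian elimination with an invertible pivot in the upper left corner. -/
theorem det_eq_pivot_mul_det {m : ℕ} (N : Matrix (Fin (m + 1)) (Fin (m + 1)) S) {u : S}
    (hu : N 0 0 * u = 1) :
    N.det = N 0 0 *
      (Matrix.of fun r j : Fin m => N r.succ j.succ - N r.succ 0 * u * N 0 j.succ).det := by
  set B : Matrix (Fin (m + 1)) (Fin (m + 1)) S :=
    Matrix.of fun r j => N r j - (if r = 0 then 0 else N r 0 * u) * N 0 j with hB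
  have hdet : N.det = B.det := by
    refine Matrix.det_eq_of_forall_row_eq_smul_add_const
      (fun r => if r = 0 then 0 else N r 0 * u) 0 (by simp) fun r j => ?_
    simp [hB]
  rw [hdet, Matrix.det_succ_column_zero, Finset.sum_eq_single 0]
  · simp [hB, Matrix.submatrix, Matrix.of_apply]
  · intro r _ hr
    have : B r 0 = 0 := by
      simp only [hB, Matrix.of_apply, if_neg hr]
      linear_combination (-N r 0) * hu
    simp [this]
  · simp

/-- The determinant of the block formed by the rows and columns `k, …, k + m - 1`. -/
def diagonalMinor (A : ℕ → ℕ → S) (k m : ℕ) : S :=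
  (Matrix.of fun r j : Fin m => A (k + r) (k + j)).det

theorem principalMinor_eq_diagonalMinor {n : ℕ} (N : Matrix (Fin n) (Fin n) S) (m : Fin n) :
    principalMinor N m = diagonalMinor (natEntry N) 0 (m + 1) := by
  unfold principalMinor diagonalMinor
  congr 1
  ext r j
  have hr : (r : ℕ) < n := by omega
  have hj : (j : ℕ) < n := by omega
  simp [natEntry, hr, hj, Fin.castLE]

variable (A : ℕ → ℕ → S) {τ σ : ℕ → S}

/-- In characteristic two the update of a right cusp is the elimination step for the pivot
`τ_k⁻¹`. -/
theorem diagonalMinor_cuspIterate (h2 : (2 : S) = 0) {k : ℕ} (hk : cuspIterate A τ k k k * τ k = 1)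
    (m : ℕ) :
    diagonalMinor (cuspIterate A τ k) k (m + 1) =
      cuspIterate A τ k k k * diagonalMinor (cuspIterate A τ (k + 1)) (k + 1) m := by
  unfold diagonalMinor
  rw [det_eq_pivot_mul_det _ (u := τ k) (by simpa using hk)]
  simp only [Matrix.of_apply, Fin.val_zero, add_zero]
  congr 2
  ext r j
  simp only [Matrix.of_apply, Fin.val_succ, cuspIterate]
  rw [show k + 1 + (r : ℕ) = k + (r + 1) by ring, show k + 1 + (j : ℕ) = k + (j + 1) by ring]
  linear_combination
    (-(cuspIterate A τ k (k + (r + 1)) k * τ k * cuspIterate A τ k k (k + (j + 1)))) * h2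

theorem diagonalMinor_eq_prod_mul (h2 : (2 : S) = 0) {m : ℕ} (hσ : ∀ k < m, σ k * τ k = 1)
    (h : ∀ k < m, cuspIterate A τ k k k = σ k) (q : ℕ) :
    diagonalMinor A 0 (m + q) =
      (∏ k ∈ Finset.range m, σ k) * diagonalMinor (cuspIterate A τ m) m q := by
  induction m generalizing q with
  | zero =>
    rw [zero_add, Finset.range_zero, Finset.prod_empty, one_mul]
    rfl
  | succ m ih =>
    have hm := h m (by omega)
    rw [add_assoc, add_comm 1 q, ih (fun k hk => hσ k (by omega)) (fun k hk => h k (by omega)),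
      diagonalMinor_cuspIterate A h2 (by rw [hm]; exact hσ m (by omega)), hm,
      Finset.prod_range_succ, mul_assoc]

/-- The pivots of the Gaussian elimination are prescribed if and only if the principal minors are
the corresponding products. -/
theorem cuspIterate_eq_iff_diagonalMinor_eq (h2 : (2 : S) = 0) {n : ℕ} (hσ : ∀ k < n, σ k * τ k = 1) :
    (∀ k < n, cuspIterate A τ k k k = σ k) ↔
      ∀ m < n, diagonalMinor A 0 (m + 1) = ∏ k ∈ Finset.range (m + 1), σ k := by
  have key (m : ℕ) (hm : m < n) (h : ∀ k < m, cuspIterate A τ k k k = σ k) :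
      diagonalMinor A 0 (m + 1) = (∏ k ∈ Finset.range m, σ k) * cuspIterate A τ m m m := by
    rw [diagonalMinor_eq_prod_mul A h2 (fun k hk => hσ k (by omega)) h]
    simp [diagonalMinor]
  constructor
  · intro h m hm
    rw [key m hm fun k hk => h k (by omega), h m hm, Finset.prod_range_succ]
  · intro h k
    induction k using Nat.strong_induction_on with
    | _ k ih =>
      intro hk
      have h1 := key k hk fun j hj => ih j hj (by omega)
      rw [h k hk, Finset.prod_range_succ] at h1
      have h3 : (∏ k ∈ Finset.range k, σ k) * ∏ k ∈ Finset.range k, τ k = 1 := by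
        rw [← Finset.prod_mul_distrib]
        exact Finset.prod_eq_one fun j hj => hσ j (by rw [Finset.mem_range] at hj; omega)
      linear_combination (σ k - cuspIterate A τ k k k) * h3 -
        (∏ k ∈ Finset.range k, τ k) * h1

end Minors

/-! ### Units with prescribed partial products -/

section Units

/-- Units with prescribed partial products of their inverses exist and are unique. -/
theorem existsUnique_prod_Iic_inv_eq {G : Type*} [CommGroup G] {n : ℕ} (d : Fin n → G) :
    ∃! t : Fin n → G, ∀ m, ∏ k ∈ Finset.Iic m, (t k)⁻¹ = d m := by
  have hIic (m : Fin n) (f : Fin n → G) :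
      ∏ k ∈ Finset.Iic m, f k = f m * ∏ k ∈ Finset.Iio m, f k := by
    rw [← Finset.Iio_insert, Finset.prod_insert (by simp)]
  set t : Fin n → G := fun k =>
    (if h : (k : ℕ) = 0 then 1 else d ⟨k - 1, by omega⟩) * (d k)⁻¹ with ht
  have hprod (m : ℕ) (hm : m < n) : ∏ k ∈ Finset.Iic (⟨m, hm⟩ : Fin n), (t k)⁻¹ = d ⟨m, hm⟩ := by
    induction m with
    | zero =>
      rw [hIic, Finset.prod_eq_one]
      · simp [ht]
      · intro k hk
        simp [Fin.lt_def] at hk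
    | succ m ih =>
      rw [hIic, show Finset.Iio (⟨m + 1, hm⟩ : Fin n) = Finset.Iic ⟨m, by omega⟩ by
        ext k; simp [Fin.lt_def, Fin.le_def], ih]
      simp [ht]
  refine ⟨t, fun m => hprod m m.isLt, fun t' ht' => ?_⟩
  funext k
  induction k using WellFoundedLT.induction with
  | ind k ih =>
    have h := (ht' k).trans (hprod k k.isLt).symm
    rw [hIic, hIic, Finset.prod_congr rfl fun j hj => by rw [ih j (Finset.mem_Iio.1 hj)]] at h
    exact inv_injective (mul_right_cancel h)

end Units

/-! ### Augmentations of the rainbow closure -/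

section Dga

variable {R T : Type} {D : LagrangianDiagram R T} {S : Type*}

theorem ceDifferential_one : ceDifferential D 1 = 0 := by
  have := ceDifferential_mark D 1
  rwa [markWord, map_one, wordElt, map_one] at this

/-- By the Leibniz rule, a ring homomorphism that kills the differentials of the Reeb chords kills
the whole image of the differential. -/
theorem map_ceDifferential_eq_zero [Semiring S] (ε : CEAlgebra R T →+* S)
    (h : ∀ c, ε (chordDifferential D c) = 0) (x : CEAlgebra R T) :
    ε (ceDifferential D x) = 0 := by
  induction x using MonoidAlgebra.induction_on with
  | of w =>
    induction w using Monoid.Coprod.induction_on with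
    | inl m =>
      induction m using FreeMonoid.inductionOn with
      | one => rw [map_one, map_one, ceDifferential_one, map_zero]
      | of c => exact (congrArg ε (ceDifferential_chord D c)).trans (h c)
      | mul x y hx hy => rw [map_mul, map_mul, ceDifferential_mul, map_add, map_mul, map_mul, hx, hy,
          zero_mul, mul_zero, add_zero]
    | inr t => exact (congrArg ε (ceDifferential_mark D t)).trans (map_zero ε)
    | mul x y hx hy => rw [map_mul, ceDifferential_mul, map_add, map_mul, map_mul, hx, hy,
          zero_mul, mul_zero, add_zero]
  | add x y hx hy => rw [map_add, map_add, hx, hy, add_zero]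
  | smul r x hx => rw [map_smul, Algebra.smul_def, map_mul, hx, mul_zero]

/-- The multiplicative map on words underlying a ring homomorphism from the dga. -/
noncomputable def wordHom [Semiring S] (ε : CEAlgebra R T →+* S) : CEWord R T →* S :=
  (ε : CEAlgebra R T →* S).comp (MonoidAlgebra.of (ZMod 2) (CEWord R T))

theorem wordHom_apply [Semiring S] (ε : CEAlgebra R T →+* S) (w : CEWord R T) :
    wordHom ε w = ε (wordElt w) := rfl

theorem HasTotal.map_chordDifferential [Semiring S] {ε : CEAlgebra R T →+* S} {c : R} {x : S}
    (h : HasTotal (fun u : ImmersedDisk D c => wordHom ε u.word) x) :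
    ε (chordDifferential D c) = x := by
  have := h.finite
  rw [← h.finsum_eq, chordDifferential]
  exact AddMonoidHom.map_finsum (ε : CEAlgebra R T →+ S) (Set.toFinite _)

/-- An augmentation is determined by its values on the Reeb chords and the formal variables. -/
theorem Augmentation.ext_generators [CommRing S] {deg : R → ℤ} {ε ε' : Augmentation D deg S}
    (hR : ∀ c, ε.toRingHom (wordElt (chordWord T c)) = ε'.toRingHom (wordElt (chordWord T c)))
    (hT : ∀ t, ε.toRingHom (wordElt (markWord R (FreeGroup.of t))) =
      ε'.toRingHom (wordElt (markWord R (FreeGroup.of t)))) : ε = ε' := by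
  have hw : wordHom ε.toRingHom = wordHom ε'.toRingHom := by
    refine Monoid.Coprod.hom_ext (FreeMonoid.hom_eq hR) ?_
    -- a homomorphism from a group to a monoid takes values in the units
    have hu : ((wordHom ε.toRingHom).comp Monoid.Coprod.inr).toHomUnits =
        ((wordHom ε'.toRingHom).comp Monoid.Coprod.inr).toHomUnits :=
      FreeGroup.ext_hom _ _ fun t => Units.ext (hT t)
    exact MonoidHom.ext fun x => congrArg Units.val (DFunLike.congr_fun hu x)
  have h : ε.toRingHom = ε'.toRingHom :=
    MonoidAlgebra.ringHom_ext
      (fun r => DFunLike.congr_fun (Subsingleton.elim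
        (ε.toRingHom.comp MonoidAlgebra.singleOneRingHom)
        (ε'.toRingHom.comp MonoidAlgebra.singleOneRingHom)) r)
      (DFunLike.congr_fun hw)
  cases ε
  cases ε'
  simpa using h

end Dga

section Points

variable {n l : ℕ} (i : Fin l → Fin (n - 1)) {S : Type*} [CommRing S]

/-- The formal variables of an augmentation as units. -/
noncomputable def BraidAug.tUnit {i : Fin l → Fin (n - 1)} (ε : BraidAug i S) (j : Fin n) : Sˣ where
  val := ε.t j
  inv := ε.toRingHom (wordElt (markWord (Fin l ⊕ Fin n) (FreeGroup.of j)⁻¹))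
  val_inv := by
    rw [BraidAug.t, ← map_mul, wordElt, wordElt, ← map_mul, markWord, markWord, ← map_mul,
      mul_inv_cancel, map_one, map_one, map_one]
  inv_val := by
    rw [BraidAug.t, ← map_mul, wordElt, wordElt, ← map_mul, markWord, markWord, ← map_mul,
      inv_mul_cancel, map_one, map_one, map_one]

/-- The equations `Δ_m(M) = ∏_{k ≤ m} t_k⁻¹` at the point `(b, t)`. -/
def SatisfiesMinorEquations (b : Fin l → S) (t : Fin n → Sˣ) : Prop :=
  ∀ m, principalMinor (braidMatrix i b) m = ((∏ k ∈ Finset.Iic m, (t k)⁻¹ : Sˣ) : S)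

variable {i}

/-- A homomorphism to a commutative ring of characteristic two kills the differentials of the Reeb
chords of the right cusps if and only if its values satisfy the equations for the principal
minors. -/
theorem map_chordDifferential_cusp_iff (h2 : (2 : S) = 0)
    (ε : CEAlgebra (Fin l ⊕ Fin n) (Fin n) →+* S) {b : Fin l → S} {t : Fin n → Sˣ}
    (hb : ∀ k, ε (wordElt (chordWord _ (.inl k))) = b k)
    (ht : ∀ j, ε (wordElt (markWord _ (FreeGroup.of j))) = t j) :
    (∀ k : Fin n, ε (chordDifferential (rainbowClosure i) (.inr k)) = 0) ↔
      SatisfiesMinorEquations i b t := by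
  set τ : ℕ → Sˣ := fun k => if h : k < n then t ⟨k, h⟩ else 1 with hτ
  have hτ' (j : Fin n) : τ j = t j := by simp [hτ]
  have hinv (k : Fin n) : wordHom ε (markWord _ (FreeGroup.of k)⁻¹) = ((τ k)⁻¹ : Sˣ) := by
    rw [eq_comm]
    refine Units.inv_eq_of_mul_eq_one_right ?_
    rw [hτ', ← ht, ← wordHom_apply, ← map_mul, markWord, markWord, ← map_mul, mul_inv_cancel,
      map_one, map_one]
  have hd (k : Fin n) := (hasTotal_immersedDisk_cusp i (wordHom ε) hb
    (τ := fun k => (τ k : S)) (fun j => (ht j).trans (by rw [hτ'])) k).map_chordDifferential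
  have hchar (x y : S) : x + y = 0 ↔ x = y :=
    ⟨fun h => by linear_combination h - y * h2, fun h => by linear_combination h + y * h2⟩
  have key := cuspIterate_eq_iff_diagonalMinor_eq (natEntry (braidMatrix i b)) h2
    (τ := fun k => (τ k : S)) (σ := fun k => ((τ k)⁻¹ : Sˣ)) (n := n) (by simp)
  calc _ ↔ ∀ k < n, cuspIterate (natEntry (braidMatrix i b)) (fun k => (τ k : S)) k k k
        = ((τ k)⁻¹ : Sˣ) := by
        rw [Fin.forall_iff]
        refine forall₂_congr fun k hk => ?_
        rw [hd, hinv, hchar]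
    _ ↔ _ := key
    _ ↔ _ := by
        rw [SatisfiesMinorEquations, Fin.forall_iff]
        refine forall₂_congr fun m hm => ?_
        rw [principalMinor_eq_diagonalMinor]
        have : ∏ k ∈ Finset.Iic (⟨m, hm⟩ : Fin n), (t k)⁻¹ =
            ∏ k ∈ Finset.range (m + 1), (τ k)⁻¹ := by
          refine Finset.prod_bij (fun k _ => (k : ℕ)) (fun k hk => ?_) (fun _ _ _ _ => Fin.ext)
            (fun k hk => ?_) (fun k _ => by rw [hτ'])
          · simpa [Fin.le_def, Nat.lt_succ_iff] using hk
          · rw [Finset.mem_range] at hk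
            exact ⟨⟨k, by omega⟩, by simp [Fin.le_def]; omega, rfl⟩
        rw [this, Units.coe_prod]

theorem BraidAug.satisfiesMinorEquations (h2 : (2 : S) = 0) (ε : BraidAug i S) :
    SatisfiesMinorEquations i ε.b ε.tUnit := by
  refine (map_chordDifferential_cusp_iff h2 ε.toRingHom (fun _ => rfl) (fun _ => rfl)).1 fun k => ?_
  rw [← ceDifferential_chord]
  exact ε.map_differential _

/-- An augmentation vanishes at the chords of the right cusps, which have degree `1`. -/
theorem BraidAug.ext_coordinates {ε ε' : BraidAug i S} (hb : ∀ k, ε.b k = ε'.b k)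
    (ht : ∀ j, ε.t j = ε'.t j) : ε = ε' := by
  refine Augmentation.ext_generators ?_ ht
  rintro (k | k)
  · exact hb k
  · have hdeg : wordDegree rainbowDegree (chordWord (Fin n) (.inr k : Fin l ⊕ Fin n)) ≠ 1 := by
      simp [wordDegree, chordWord, rainbowDegree, ← ofAdd_zero]
    rw [ε.map_of_degree_ne _ hdeg, ε'.map_of_degree_ne _ hdeg]

/-- The values at words of the augmentation with coordinates `(b, t)`. -/
def pointWordHom (b : Fin l → S) (t : Fin n → Sˣ) : CEWord (Fin l ⊕ Fin n) (Fin n) →* S :=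
  Monoid.Coprod.lift (FreeMonoid.lift (Sum.elim b 0)) ((Units.coeHom S).comp (FreeGroup.lift t))

/-- A word of nonzero degree contains the chord of a right cusp. -/
theorem pointWordHom_eq_zero (b : Fin l → S) (t : Fin n → Sˣ) (w : CEWord (Fin l ⊕ Fin n) (Fin n)) :
    wordDegree rainbowDegree w = 1 ∨ pointWordHom b t w = 0 := by
  have hmul {x y : CEWord (Fin l ⊕ Fin n) (Fin n)}
      (hx : wordDegree rainbowDegree x = 1 ∨ pointWordHom b t x = 0)
      (hy : wordDegree rainbowDegree y = 1 ∨ pointWordHom b t y = 0) :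
      wordDegree rainbowDegree (x * y) = 1 ∨ pointWordHom b t (x * y) = 0 := by
    rw [map_mul, map_mul]
    rcases hx with hx | hx
    · rcases hy with hy | hy
      · exact .inl (by rw [hx, hy, one_mul])
      · exact .inr (by rw [hy, mul_zero])
    · exact .inr (by rw [hx, zero_mul])
  induction w using Monoid.Coprod.induction_on with
  | inl m =>
    induction m using FreeMonoid.inductionOn with
    | one => exact .inl (by rw [map_one, map_one])
    | of c =>
      cases c with
      | inl k => exact .inl (by simp [wordDegree, rainbowDegree])
      | inr k => exact .inr (by simp [pointWordHom])
    | mul x y hx hy => rw [map_mul]; exact hmul hx hy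
  | inr t => exact .inl (by simp [wordDegree])
  | mul x y hx hy => exact hmul hx hy

/-- The augmentation with given coordinates that satisfy the equations. -/
noncomputable def BraidAug.ofPoint [Algebra (ZMod 2) S] (h2 : (2 : S) = 0) {b : Fin l → S}
    {t : Fin n → Sˣ} (h : SatisfiesMinorEquations i b t) : BraidAug i S where
  toRingHom := (MonoidAlgebra.lift (ZMod 2) S _ (pointWordHom b t)).toRingHom
  map_differential := by
    refine map_ceDifferential_eq_zero _ ?_
    rintro (k | k)
    · have := isEmpty_immersedDisk_braid i k
      exact (HasTotal.of_isEmpty _).map_chordDifferential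
    · exact (map_chordDifferential_cusp_iff h2 _
        (fun k => by simp [wordElt, pointWordHom, chordWord])
        (fun j => by simp [wordElt, pointWordHom, markWord])).2 h k
  map_of_degree_ne w hw := by
    have := (pointWordHom_eq_zero b t w).resolve_left hw
    simpa [wordElt] using this

theorem BraidAug.ofPoint_b [Algebra (ZMod 2) S] (h2 : (2 : S) = 0) {b : Fin l → S}
    {t : Fin n → Sˣ} (h : SatisfiesMinorEquations i b t) (k : Fin l) :
    (BraidAug.ofPoint h2 h).b k = b k := by
  simp [BraidAug.ofPoint, BraidAug.b, wordElt, pointWordHom, chordWord]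

theorem BraidAug.ofPoint_t [Algebra (ZMod 2) S] (h2 : (2 : S) = 0) {b : Fin l → S}
    {t : Fin n → Sˣ} (h : SatisfiesMinorEquations i b t) (j : Fin n) :
    (BraidAug.ofPoint h2 h).t j = t j := by
  simp [BraidAug.ofPoint, BraidAug.t, wordElt, pointWordHom, markWord]

end Points

/-! ### The coordinate ring -/

section Ring

variable {F : Type*} [CommRing F] {n l : ℕ} {S : Type*} [CommRing S] [Algebra F S]

theorem MixedLaurent.algHom_ext {f g : MixedLaurent F l n →ₐ[F] S}
    (hb : ∀ k, f (MixedLaurent.b F n k) = g (MixedLaurent.b F n k))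
    (ht : ∀ j, f (MixedLaurent.t F l j 1) = g (MixedLaurent.t F l j 1)) : f = g := by
  apply AddMonoidAlgebra.algHom_ext'
  rotate_left
  · exact Subsingleton.elim _ _
  apply MonoidHom.toAdditiveRight.injective
  refine (AddMonoidHom.coprod_unique _).symm.trans
    (Eq.trans (congrArg₂ AddMonoidHom.coprod ?_ ?_) (AddMonoidHom.coprod_unique _))
  · refine Finsupp.addHom_ext' fun k => AddMonoidHom.ext_nat ?_
    exact hb k
  · refine Finsupp.addHom_ext' fun j => AddMonoidHom.ext_int ?_
    exact ht j

/-- The value at a monomial of the homomorphism with coordinates `(b, t)`. -/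
def MixedLaurent.monomialHom (b : Fin l → S) (t : Fin n → Sˣ) :
    Multiplicative ((Fin l →₀ ℕ) × (Fin n →₀ ℤ)) →* S where
  toFun x := (∏ k, b k ^ x.toAdd.1 k) * ((∏ j, t j ^ x.toAdd.2 j : Sˣ) : S)
  map_one' := by simp
  map_mul' x y := by
    simp only [toAdd_mul, Prod.fst_add, Prod.snd_add, Finsupp.add_apply, pow_add, zpow_add,
      Finset.prod_mul_distrib, Units.val_mul]
    ring

/-- The homomorphism with coordinates `(b, t)`. -/
noncomputable def MixedLaurent.evalHom (b : Fin l → S) (t : Fin n → Sˣ) :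
    MixedLaurent F l n →ₐ[F] S :=
  AddMonoidAlgebra.lift F S _ (MixedLaurent.monomialHom b t)

theorem MixedLaurent.evalHom_b (b : Fin l → S) (t : Fin n → Sˣ) (k : Fin l) :
    MixedLaurent.evalHom (F := F) b t (MixedLaurent.b F n k) = b k := by
  rw [MixedLaurent.evalHom, MixedLaurent.b, AddMonoidAlgebra.lift_single, one_smul]
  simp [MixedLaurent.monomialHom, Finsupp.single_apply, Finset.prod_ite_eq, pow_ite]

theorem MixedLaurent.evalHom_t (b : Fin l → S) (t : Fin n → Sˣ) (j : Fin n) (z : ℤ) :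
    MixedLaurent.evalHom (F := F) b t (MixedLaurent.t F l j z) = (t j ^ z : Sˣ) := by
  rw [MixedLaurent.evalHom, MixedLaurent.t, AddMonoidAlgebra.lift_single, one_smul]
  simp only [MixedLaurent.monomialHom, MonoidHom.coe_mk, OneHom.coe_mk, toAdd_ofAdd,
    Finsupp.coe_zero, Pi.zero_apply, pow_zero, Finset.prod_const_one, one_mul]
  rw [Finset.prod_eq_single j (fun k _ hk => by rw [Finsupp.single_eq_of_ne hk, zpow_zero])
    (by simp), Finsupp.single_eq_same]

theorem braidZ_map {S' : Type*} [CommRing S'] (f : S →+* S') (q : Fin (n - 1)) (b : S) :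
    f.mapMatrix (braidZ q b) = braidZ q (f b) := by
  ext r c
  simp only [RingHom.mapMatrix_apply, Matrix.map_apply, braidZ, Matrix.of_apply]
  split_ifs <;> simp

theorem principalMinor_braidMatrix_map {S' : Type*} [CommRing S'] (f : S →+* S')
    (i : Fin l → Fin (n - 1)) (b : Fin l → S) (m : Fin n) :
    f (principalMinor (braidMatrix i b) m) =
      principalMinor (braidMatrix i fun k => f (b k)) m := by
  have h : f.mapMatrix (braidMatrix i b) = braidMatrix i fun k => f (b k) := by
    rw [braidMatrix, map_list_prod, List.map_ofFn, braidMatrix]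
    simp only [Function.comp_def, braidZ_map]
  rw [← h, principalMinor, RingHom.map_det, principalMinor]
  rfl

variable (i : Fin l → Fin (n - 1))

theorem MinorRing.algHom_ext {f g : MinorRing F i →ₐ[F] S}
    (hb : ∀ k, f (MinorRing.b F i k) = g (MinorRing.b F i k))
    (ht : ∀ j, f (MinorRing.t F i j) = g (MinorRing.t F i j)) : f = g :=
  Ideal.Quotient.algHom_ext _ (MixedLaurent.algHom_ext hb ht)

variable {i} in
/-- The homomorphism with given coordinates that satisfy the equations. -/
noncomputable def MinorRing.ofPoint {b : Fin l → S} {t : Fin n → Sˣ}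
    (h : SatisfiesMinorEquations i b t) : MinorRing F i →ₐ[F] S :=
  Ideal.Quotient.liftₐ _ (MixedLaurent.evalHom b t) fun x hx => by
    have hle : minorIdeal F i ≤ RingHom.ker (MixedLaurent.evalHom (F := F) b t) := by
      rw [minorIdeal, Ideal.span_le]
      rintro _ ⟨m, rfl⟩
      have h1 := principalMinor_braidMatrix_map (MixedLaurent.evalHom (F := F) b t).toRingHom i
        (fun k => MixedLaurent.b F n k) m
      simp only [AlgHom.toRingHom_eq_coe, RingHom.coe_coe, MixedLaurent.evalHom_b] at h1
      rw [SetLike.mem_coe, RingHom.mem_ker, map_sub, h1, h m, map_prod, Units.coe_prod]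
      simp only [MixedLaurent.evalHom_t, zpow_neg, zpow_one, sub_self]
    exact hle hx

theorem MinorRing.ofPoint_b {b : Fin l → S} {t : Fin n → Sˣ}
    (h : SatisfiesMinorEquations i b t) (k : Fin l) :
    MinorRing.ofPoint (F := F) h (MinorRing.b F i k) = b k :=
  MixedLaurent.evalHom_b b t k

theorem MinorRing.ofPoint_t {b : Fin l → S} {t : Fin n → Sˣ}
    (h : SatisfiesMinorEquations i b t) (j : Fin n) :
    MinorRing.ofPoint (F := F) h (MinorRing.t F i j) = t j :=
  (MixedLaurent.evalHom_t b t j 1).trans (by rw [zpow_one])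

variable (F) in
/-- The class of `t_j` as a unit. -/
noncomputable def MinorRing.tUnit (j : Fin n) : (MinorRing F i)ˣ where
  val := MinorRing.t F i j
  inv := Ideal.Quotient.mk _ (MixedLaurent.t F l j (-1))
  val_inv := by
    rw [MinorRing.t, ← map_mul, MixedLaurent.t, MixedLaurent.t, AddMonoidAlgebra.single_mul_single,
      Prod.mk_add_mk, ← Finsupp.single_add]
    simp [← AddMonoidAlgebra.one_def, ← Prod.zero_eq_mk]
  inv_val := by
    rw [MinorRing.t, ← map_mul, MixedLaurent.t, MixedLaurent.t, AddMonoidAlgebra.single_mul_single,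
      Prod.mk_add_mk, ← Finsupp.single_add]
    simp [← AddMonoidAlgebra.one_def, ← Prod.zero_eq_mk]

theorem MinorRing.satisfiesMinorEquations_self :
    SatisfiesMinorEquations i (MinorRing.b F i) (MinorRing.tUnit F i) := by
  intro m
  have h := Ideal.Quotient.eq.2 (Ideal.subset_span
    (Set.mem_range_self (f := fun m : Fin n =>
      principalMinor (braidMatrix i fun k => MixedLaurent.b F n k) m -
        ∏ k ∈ Finset.Iic m, MixedLaurent.t F l k (-1)) m) : _ ∈ minorIdeal F i)
  rw [principalMinor_braidMatrix_map, map_prod] at h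
  rw [Units.coe_prod]
  exact h

theorem SatisfiesMinorEquations.map {S' : Type*} [CommRing S'] {i : Fin l → Fin (n - 1)}
    {b : Fin l → S} {t : Fin n → Sˣ} (h : SatisfiesMinorEquations i b t) (f : S →+* S') :
    SatisfiesMinorEquations i (fun k => f (b k)) (fun j => Units.map f (t j)) := by
  intro m
  rw [← principalMinor_braidMatrix_map, h m]
  have hmap : Units.map (f : S →* S') (∏ k ∈ Finset.Iic m, (t k)⁻¹) =
      ∏ k ∈ Finset.Iic m, (Units.map (f : S →* S') (t k))⁻¹ := by
    simp only [map_prod, map_inv]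
  exact congrArg Units.val hmap

theorem SatisfiesMinorEquations.unique {i : Fin l → Fin (n - 1)} {b : Fin l → S}
    {t t' : Fin n → Sˣ} (h : SatisfiesMinorEquations i b t)
    (h' : SatisfiesMinorEquations i b t') : t = t' :=
  (existsUnique_prod_Iic_inv_eq fun m => ∏ k ∈ Finset.Iic m, (t k)⁻¹).unique (fun _ => rfl)
    fun m => Units.ext ((h' m).symm.trans (h m))

/-- The equations can be solved for `t` exactly where all principal minors are units. -/
theorem exists_satisfiesMinorEquations_iff (b : Fin l → S) :
    (∃ t, SatisfiesMinorEquations i b t) ↔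
      IsUnit (MvPolynomial.aeval (R := F) b (minorProduct F i)) := by
  have h (m : Fin n) : MvPolynomial.aeval (R := F) b
      (principalMinor (braidMatrix i fun k => MvPolynomial.X k) m) =
        principalMinor (braidMatrix i b) m := by
    have := principalMinor_braidMatrix_map (MvPolynomial.aeval (R := F) b).toRingHom i
        (fun k => MvPolynomial.X k) m
    simpa using this
  rw [minorProduct, map_prod, IsUnit.prod_univ_iff]
  simp only [h]
  constructor
  · rintro ⟨t, ht⟩ m
    rw [ht m]
    exact Units.isUnit _
  · intro hu
    obtain ⟨t, ht, -⟩ := existsUnique_prod_Iic_inv_eq fun m => (hu m).unit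
    exact ⟨t, fun m => by rw [ht m, IsUnit.unit_spec]⟩

/-- The algebra structure of the coordinate ring over the polynomial ring in the Reeb coordinates,
which underlies `reebCoordinates`. -/
noncomputable abbrev MinorRing.reebAlgebra : Algebra (MvPolynomial (Fin l) F) (MinorRing F i) :=
  (MvPolynomial.aeval (R := F) (fun k => MinorRing.b F i k)).toRingHom.toAlgebra

/-- The coordinate ring is the localization of the polynomial ring in the Reeb coordinates at the
product of the minors: inverting the minors makes the equations solvable for `t`, uniquely. -/
theorem MinorRing.isLocalization_away :
    letI := MinorRing.reebAlgebra (F := F) i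
    IsLocalization.Away (minorProduct F i) (MinorRing F i) := by
  let _ := MinorRing.reebAlgebra (F := F) i
  set L := Localization.Away (minorProduct F i)
  have hunit : IsUnit (algebraMap (MvPolynomial (Fin l) F) (MinorRing F i) (minorProduct F i)) :=
    (exists_satisfiesMinorEquations_iff (F := F) i (MinorRing.b F i)).1
      ⟨_, MinorRing.satisfiesMinorEquations_self i⟩
  set x : Fin l → L := fun k => algebraMap (MvPolynomial (Fin l) F) L (MvPolynomial.X k) with hx
  have haeval : (MvPolynomial.aeval (R := F) x).toRingHom =
      algebraMap (MvPolynomial (Fin l) F) L := by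
    have : MvPolynomial.aeval (R := F) x = IsScalarTower.toAlgHom F _ L := by
      ext k
      simp [hx]
    rw [this]
    rfl
  have hpoint : ∃ t, SatisfiesMinorEquations i x t := by
    rw [exists_satisfiesMinorEquations_iff (F := F)]
    have := IsLocalization.Away.algebraMap_isUnit (S := L) (minorProduct F i)
    rwa [← haeval] at this
  obtain ⟨t, ht⟩ := hpoint
  let f : MinorRing F i →ₐ[F] L := MinorRing.ofPoint ht
  let g : L →+* MinorRing F i := IsLocalization.Away.lift (minorProduct F i) hunit
  have hg (p) : g (algebraMap _ L p) = algebraMap _ (MinorRing F i) p :=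
    IsLocalization.Away.lift_eq _ hunit p
  have hf : f.toRingHom.comp (algebraMap (MvPolynomial (Fin l) F) (MinorRing F i)) =
      algebraMap _ L := by
    rw [← haeval]
    have : f.comp (MvPolynomial.aeval (R := F) (fun k => MinorRing.b F i k)) =
        MvPolynomial.aeval (R := F) x := by
      ext k
      simp [f, MinorRing.ofPoint_b]
    exact congrArg AlgHom.toRingHom this
  let gF : L →ₐ[F] MinorRing F i :=
    { g with
      commutes' := fun r => by
        have := hg (MvPolynomial.C r)
        rw [← MvPolynomial.algebraMap_eq, ← IsScalarTower.algebraMap_apply] at this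
        exact this.trans (MvPolynomial.aeval_C _ r) }
  have hgx (k : Fin l) : g (x k) = MinorRing.b F i k :=
    (hg (MvPolynomial.X k)).trans (MvPolynomial.aeval_X _ k)
  have hgf : gF.comp f = AlgHom.id F _ := by
    refine MinorRing.algHom_ext i (fun k => ?_) fun j => ?_
    · exact (congrArg g (MinorRing.ofPoint_b i ht k)).trans (hgx k)
    · have h1 := ht.map g
      simp only [hgx] at h1
      have h2 := congrFun (h1.unique (MinorRing.satisfiesMinorEquations_self i)) j
      exact (congrArg g (MinorRing.ofPoint_t i ht j)).trans (congrArg Units.val h2)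
  have hfg : f.toRingHom.comp g = RingHom.id L := by
    refine IsLocalization.ringHom_ext (Submonoid.powers (minorProduct F i)) ?_
    refine RingHom.ext fun p => ?_
    exact (congrArg f (hg p)).trans (DFunLike.congr_fun hf p)
  exact IsLocalization.isLocalization_of_algEquiv _ (AlgEquiv.ofRingEquiv
    (f := RingEquiv.ofRingHom g f.toRingHom (congrArg AlgHom.toRingHom hgf) hfg) hg)

end Ring

/-! ### The morphism given by the Reeb coordinates -/

section Scheme

variable (F : Type u) [CommRing F] {n l : ℕ} (i : Fin l → Fin (n - 1))

theorem isOpenImmersion_reebCoordinates : IsOpenImmersion (reebCoordinates F i) := by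
  let _ := MinorRing.reebAlgebra (F := F) i
  have := MinorRing.isLocalization_away (F := F) i
  exact IsOpenImmersion.of_isLocalization (S := MinorRing F i) (minorProduct F i)

theorem opensRange_reebCoordinates [IsOpenImmersion (reebCoordinates F i)] :
    (reebCoordinates F i).opensRange = PrimeSpectrum.basicOpen (minorProduct F i) := by
  let _ := MinorRing.reebAlgebra (F := F) i
  have := MinorRing.isLocalization_away (F := F) i
  ext1
  exact PrimeSpectrum.localization_away_comap_range (MinorRing F i) (minorProduct F i)

end Scheme

/-! ### Augmentations as points of the coordinate ring -/

section Equivalence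

variable {F : Type*} [CommRing F] {n l : ℕ} {i : Fin l → Fin (n - 1)} {S : Type*} [CommRing S]
  [Algebra F S]

theorem MinorRing.map_satisfiesMinorEquations (f : MinorRing F i →ₐ[F] S) :
    SatisfiesMinorEquations i (fun k => f (MinorRing.b F i k))
      (fun j => Units.map f (MinorRing.tUnit F i j)) :=
  (MinorRing.satisfiesMinorEquations_self i).map f.toRingHom

variable (F) in
/-- Augmentations correspond to homomorphisms from the coordinate ring. -/
noncomputable def BraidAug.equivAlgHom [Algebra (ZMod 2) S] (h2 : (2 : S) = 0) :
    BraidAug i S ≃ (MinorRing F i →ₐ[F] S) where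
  toFun ε := MinorRing.ofPoint (ε.satisfiesMinorEquations h2)
  invFun f := BraidAug.ofPoint h2 (MinorRing.map_satisfiesMinorEquations f)
  left_inv ε := BraidAug.ext_coordinates
    (fun k => (BraidAug.ofPoint_b h2 _ k).trans (MinorRing.ofPoint_b i _ k))
    (fun j => (BraidAug.ofPoint_t h2 _ j).trans
      (MinorRing.ofPoint_t i (ε.satisfiesMinorEquations h2) j))
  right_inv _ := MinorRing.algHom_ext i
    (fun k => (MinorRing.ofPoint_b i _ k).trans (BraidAug.ofPoint_b h2 _ k))
    (fun j => (MinorRing.ofPoint_t i _ j).trans (BraidAug.ofPoint_t h2 _ j))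

theorem BraidAug.equivAlgHom_b [Algebra (ZMod 2) S] (h2 : (2 : S) = 0) (ε : BraidAug i S)
    (k : Fin l) : BraidAug.equivAlgHom F h2 ε (MinorRing.b F i k) = ε.b k :=
  MinorRing.ofPoint_b i (ε.satisfiesMinorEquations h2) k

theorem BraidAug.equivAlgHom_t [Algebra (ZMod 2) S] (h2 : (2 : S) = 0) (ε : BraidAug i S)
    (j : Fin n) : BraidAug.equivAlgHom F h2 ε (MinorRing.t F i j) = ε.t j :=
  MinorRing.ofPoint_t i (ε.satisfiesMinorEquations h2) j

theorem BraidAug.injective_b (h2 : (2 : S) = 0) :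
    Function.Injective (fun ε : BraidAug i S => ε.b) := by
  intro ε ε' h
  have h1 := ε.satisfiesMinorEquations h2
  have h1' := ε'.satisfiesMinorEquations h2
  rw [show ε.b = ε'.b from h] at h1
  exact BraidAug.ext_coordinates (congrFun h)
    fun j => congrArg Units.val (congrFun (h1.unique h1') j)

theorem BraidAug.range_b [Algebra (ZMod 2) S] (h2 : (2 : S) = 0) :
    Set.range (fun ε : BraidAug i S => ε.b) =
      {x : Fin l → S | IsUnit (MvPolynomial.aeval x (minorProduct F i))} := by
  ext x
  rw [Set.mem_ofPred_eq, ← exists_satisfiesMinorEquations_iff]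
  constructor
  · rintro ⟨ε, rfl⟩
    exact ⟨_, ε.satisfiesMinorEquations h2⟩
  · rintro ⟨t, ht⟩
    exact ⟨BraidAug.ofPoint h2 ht, funext (BraidAug.ofPoint_b h2 ht)⟩

end Equivalence

theorem proposition2p13 {F : Type u} [Field F] [IsAlgClosed F] [CharP F 2]
    {n l : ℕ} (i : Fin l → Fin (n - 1)) :
    (∃ Φ : ∀ (S : Type u) [CommRing S] [Algebra F S], BraidAug i S ≃ (MinorRing F i →ₐ[F] S),
      (∀ (S : Type u) [CommRing S] [Algebra F S] (ε : BraidAug i S) (k : Fin l),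
        Φ S ε (MinorRing.b F i k) = ε.b k) ∧
      (∀ (S : Type u) [CommRing S] [Algebra F S] (ε : BraidAug i S) (j : Fin n),
        Φ S ε (MinorRing.t F i j) = ε.t j) ∧
      (∀ (S S' : Type u) [CommRing S] [Algebra F S] [CommRing S'] [Algebra F S']
        (g : S →ₐ[F] S') (ε : BraidAug i S),
        Φ S' (ε.map g.toRingHom) = g.comp (Φ S ε))) ∧
    (∀ (S : Type u) [CommRing S] [Algebra F S],
      Function.Injective (fun ε : BraidAug i S => ε.b) ∧
      Set.range (fun ε : BraidAug i S => ε.b) =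
        {x : Fin l → S | IsUnit (MvPolynomial.aeval x (minorProduct F i))}) ∧
    Set.range (fun ε : BraidAug i F => ε.b) =
      {x : Fin l → F | MvPolynomial.eval x (minorProduct F i) ≠ 0} ∧
    ∃ _ : IsOpenImmersion (reebCoordinates F i),
      (reebCoordinates F i).opensRange = PrimeSpectrum.basicOpen (minorProduct F i) := by
  have h2 (S : Type u) [CommRing S] [Algebra F S] : (2 : S) = 0 := by
    rw [← map_ofNat (algebraMap F S) 2, show (OfNat.ofNat 2 : F) = 0 from CharTwo.two_eq_zero,
      map_zero]
  -- `ZMod 2` acts through `F`; the algebra `S` may be zero, so `CharP S 2` is not available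
  let alg (S : Type u) [CommRing S] [Algebra F S] : Algebra (ZMod 2) S :=
    ((algebraMap F S).comp (ZMod.castHom dvd_rfl F)).toAlgebra
  have hrange (S : Type u) [CommRing S] [Algebra F S] :
      Set.range (fun ε : BraidAug i S => ε.b) =
        {x : Fin l → S | IsUnit (MvPolynomial.aeval x (minorProduct F i))} :=
    letI := alg S
    BraidAug.range_b (h2 S)
  refine ⟨⟨fun S _ _ => letI := alg S; BraidAug.equivAlgHom F (h2 S),
    fun S _ _ ε k => letI := alg S; BraidAug.equivAlgHom_b (h2 S) ε k,
    fun S _ _ ε j => letI := alg S; BraidAug.equivAlgHom_t (h2 S) ε j,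
    fun S S' _ _ _ _ g ε => ?_⟩, fun S _ _ => ⟨BraidAug.injective_b (h2 S), hrange S⟩, ?_,
    isOpenImmersion_reebCoordinates F i, ?_⟩
  · let _ := alg S
    let _ := alg S'
    exact MinorRing.algHom_ext i
      (fun k => (BraidAug.equivAlgHom_b (h2 S') (ε.map g.toRingHom) k).trans
        (congrArg g (BraidAug.equivAlgHom_b (h2 S) ε k)).symm)
      (fun j => (BraidAug.equivAlgHom_t (h2 S') (ε.map g.toRingHom) j).trans
        (congrArg g (BraidAug.equivAlgHom_t (h2 S) ε j)).symm)
  · rw [hrange F]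
    simp only [isUnit_iff_ne_zero]
    rfl
  · have := isOpenImmersion_reebCoordinates F i
    exact opensRange_reebCoordinates F i
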